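/- Notation. $\mathbb D$ is the open unit disc, $\mathbb T$ the unit circle, $\sigma$ normalized Lebesgue measure on $\mathbb T$. $H^2$ is the Hilbert space of functions $f(z)=\sum_{k\ge0}c_kz^k$ on $\mathbb D$ with $\|f\|^2=\sum_k|c_k|^2<\infty$; on $\mathbb T$, $f$ is given by its radial limits. For a bounded operator $T$ on $H^2$, $a_n(T)$ is the distance in operator norm from $T$ to the operators of rank $<n$. The Carleson norm $\|\mu\|_{\mathcal C}\in[0,\infty]$ of a nonnegative Borel measure $\mu$ on $\overline{\mathbb D}$ is the smallest $K$ with $\int_{\overline{\mathbb D}}|f|^2\,d\mu\le K\|f\|^2$ for all $f\in H^2$ ($\infty$ if there is no such finite $K$). For a sequence $Z=(z_j)$ in $\mathbb D$, $\upsilon_Z=\sum_j(1-|z_j|^2)\delta_{z_j}$, and the constant of interpolation $M(Z)$ is the smallest $C$ such that whenever $\sum_j|a_j|^2(1-|z_j|^2)<\infty$ there is $f\in H^2$ with $f(z_j)=a_j$ for all $j$ and $\|f\|\le C\big(\sum_j|a_j|^2(1-|z_j|^2)\big)^{1/2}$. Theorem. Let $\varphi:\mathbb D\to\mathbb D$ be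 analytic. Then $C_\varphi f=f\circ\varphi$ defines a bounded operator on $H^2$, and $\varphi$ has radial limits at $\sigma$-almost every point of $\mathbb T$. Write $\varphi$ also for any function on $\mathbb T$ that agrees $\sigma$-almost everywhere with these radial limits, and for $0<r<1$ let $\mu_{\varphi,r}(E)=\sigma(\{z\in\mathbb T:|\varphi(z)|>r,\ \varphi(z)\in E\})$. Let $n\ge1$. (a) For every Blaschke product $B(z)=z^m\prod_{j=1}^{n-1-m}\frac{w_j-z}{1-\overline{w_j}z}$ of degree $n-1$ (where $0\le m\le n-1$ and the $w_j\in\mathbb D\setminus\{0\}$ are not necessarily distinct) and every $0<r<1$, $$a_n(C_\varphi)\le\Big(\sup_{z\in\mathbb T:\,|\varphi(z)|\le r}|B(\varphi(z))|^2\,\|C_\varphi\|^2+\|\mu_{\varphi,r}\|_{\mathcal C}\Big)^{1/2},$$ where the supremum over the empty set is $0$. (b) If $Z=(z_1,\dots,z_n)$ consists of $n$ distinct points of $\mathbb D$ whose images $\varphi(Z)=(\varphi(z_1),\dots,\varphi(z_n))$ are also distinct, then $$a_n(C_\varphi)\ge[M(\varphi(Z))]^{-1}\,\|\upsilon_Z\|_{\mathcal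 C}^{-1/2}\inf_{1\le j\le n}\Big(\frac{1-|z_j|^2}{1-|\varphi(z_j)|^2}\Big)^{1/2}.$$ -/

import Mathlib

open scoped ENNReal

noncomputable section

/-- The Hardy space `H²` of the unit disc: power series `∑ aₖ zᵏ` with square summable
coefficients, with the norm `(∑ |aₖ|²)^(1/2)`. An element is stored as its coefficient sequence;
`HardyTwo.eval` is the analytic function on the disc. -/
abbrev HardyTwo : Type := lp (fun _ : ℕ => ℂ) 2

/-- The value at a point `z` of the open unit disc. -/
def HardyTwo.eval (f : HardyTwo) (z : ℂ) : ℂ := ∑' k : ℕ, f k * z ^ k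

/-- A function in `H²` on the closed unit disc: its values inside, its radial limits (where they
exist) on the unit circle. -/
def HardyTwo.ext (f : HardyTwo) (z : ℂ) : ℂ :=
  open Classical in
  if ‖z‖ < 1 then f.eval z
  else Filter.limUnder (nhdsWithin (1 : ℝ) (Set.Iio 1)) (fun t : ℝ => f.eval ((t : ℂ) * z))

/-- Normalized Lebesgue measure on the unit circle, as a measure on `ℂ`. -/
def circleSigma : MeasureTheory.Measure ℂ :=
  (ENNReal.ofReal (2 * Real.pi))⁻¹ •
    (MeasureTheory.volume.restrict (Set.Ioc 0 (2 * Real.pi))).map (circleMap 0 1)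

/-- The bounded operator `C` on `H²` is `f ↦ f ∘ φ`. -/
def IsCompositionOperator (φ : ℂ → ℂ) (C : HardyTwo →L[ℂ] HardyTwo) : Prop :=
  ∀ f : HardyTwo, ∀ z ∈ Metric.ball (0 : ℂ) 1, (C f).eval z = f.eval (φ z)

/-- `φb` is a version of the boundary function of `φ`: its value at almost every point of the
unit circle is the radial limit of `φ`. -/
def IsBoundaryFunction (φ φb : ℂ → ℂ) : Prop :=
  ∀ᵐ z ∂circleSigma,
    Filter.Tendsto (fun t : ℝ => φ ((t : ℂ) * z)) (nhdsWithin (1 : ℝ) (Set.Iio 1)) (nhds (φb z))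

/-- The `n`th approximation number: the distance in operator norm to the operators of
rank `< n`. -/
def approxNumber (n : ℕ) (T : HardyTwo →L[ℂ] HardyTwo) : ℝ≥0∞ :=
  Metric.infEDist T {R : HardyTwo →L[ℂ] HardyTwo |
    LinearMap.rank (R : HardyTwo →ₗ[ℂ] HardyTwo) < (n : Cardinal)}

/-- The Carleson norm of a measure on the closed unit disc: the smallest `K` with
`∫ |f|² dμ ≤ K ‖f‖²` for all `f` in `H²`, and `∞` if there is no finite such `K`. -/
def carlesonNorm (μ : MeasureTheory.Measure ℂ) : ℝ≥0∞ :=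
  sInf {K : ℝ≥0∞ | ∀ f : HardyTwo,
    ∫⁻ z in Metric.closedBall (0 : ℂ) 1, ‖f.ext z‖ₑ ^ 2 ∂μ ≤ K * ‖f‖ₑ ^ 2}

/-- The pullback measure `μ_{φ,r}` on `r < |w| ≤ 1`, given the boundary function of `φ`. -/
def pullbackMeasure (φb : ℂ → ℂ) (r : ℝ) : MeasureTheory.Measure ℂ :=
  (circleSigma.map φb).restrict {w : ℂ | r < ‖w‖}

/-- The measure `υ_Z = ∑ⱼ (1 - |zⱼ|²) δ_{zⱼ}`. -/
def sequenceMeasure {ι : Type*} (Z : ι → ℂ) : MeasureTheory.Measure ℂ :=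
  MeasureTheory.Measure.sum fun j =>
    ENNReal.ofReal (1 - ‖Z j‖ ^ 2) • MeasureTheory.Measure.dirac (Z j)

/-- The constant of interpolation `M(Z)`: the smallest `C` such that each interpolation problem
`f(zⱼ) = aⱼ` with `∑ |aⱼ|² (1 - |zⱼ|²) < ∞` has a solution `f` in `H²` with
`‖f‖ ≤ C (∑ |aⱼ|² (1 - |zⱼ|²))^(1/2)`. -/
def interpolationConst {ι : Type*} (Z : ι → ℂ) : ℝ≥0∞ :=
  sInf {C : ℝ≥0∞ | ∀ a : ι → ℂ,
    (∑' j, ‖a j‖ₑ ^ 2 * ENNReal.ofReal (1 - ‖Z j‖ ^ 2)) < ∞ →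
    ∃ f : HardyTwo, (∀ j, f.eval (Z j) = a j) ∧
      ‖f‖ₑ ≤ C * (∑' j, ‖a j‖ₑ ^ 2 * ENNReal.ofReal (1 - ‖Z j‖ ^ 2)) ^ (1 / 2 : ℝ)}

/-- `B` is a finite Blaschke product of degree `d`. -/
def IsBlaschkeProduct (d : ℕ) (B : ℂ → ℂ) : Prop :=
  ∃ m : ℕ, m ≤ d ∧ ∃ a : Fin (d - m) → ℂ, (∀ j, ‖a j‖ < 1 ∧ a j ≠ 0) ∧
    ∀ z, B z = z ^ m * ∏ j, (a j - z) / (1 - (starRingEnd ℂ) (a j) * z)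

end

/-! Boundedness is Littlewood's subordination principle. If `h` is analytic in the disc and `|f|² ≤
Re h`, then the mean of `|f ∘ φ|²` over the circle of radius `t` is at most `Re h (φ 0)`, by the
mean value property of `h ∘ φ`; this bound does not depend on `t`, so `f ∘ φ` is in `H²`. The
majorant comes from the backward shift `L` (`exists_analytic_majorant`): `g = (1 - wL)⁻¹ f` has
constant coefficient `f(w)`, and `Re ⟪f, (1 + wL) g⟫ = ‖g‖² - ‖wLg‖²`.

Radial limits come from differentiating a primitive `Φ` of `φ`. It is Lipschitz because `φ` is
bounded, hence differentiable along the circle at almost every point. At such a point a Cauchy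
formula for `Φ' = φ`, with a reflected kernel subtracted so that a Poisson kernel controls it, gives
the radial limit (`tendsto_deriv_radial`).

For (a), write `|B| = |P| / |Q|` on the closed disc with polynomials satisfying `|P| = |Q|` on the
circle and `P` monic of degree `n - 1`. The closure `E` of the multiples of `P` has codimension at
most `n - 1`, so `C` composed with the projection onto `Eᗮ` has rank less than `n`, and the error is
`C` on `E`. There `‖C (P p)‖²` is the integral of `|P p|²` against the pullback of `σ` under the
boundary function. The part `|w| > r` is a Carleson integral; on `|w| ≤ r` a factor `|B|²` comes out
and leaves at most `‖C (Q p)‖² ≤ ‖C‖² ‖Q p‖² = ‖C‖² ‖P p‖²` (`enorm_sq_comp_mul_le`).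

For (b), an operator `R` of rank less than `n` satisfies a nontrivial relation `∑ αⱼ (R f)(zⱼ) = 0`
for all `f`. Interpolation at the points `φ(zⱼ)` provides an `f` of controlled norm for which `∑ αⱼ
(C f)(zⱼ)` is large. Since `∑ αⱼ ((C - R) f)(zⱼ)` has the same value, Cauchy–Schwarz and the
Carleson inequality bound `‖C - R‖` from below (`exists_ratio_le_of_rank_lt`). -/

section

open MeasureTheory Filter Topology Metric Set

/-! ### Integration on the circle and Parseval's identity -/

/-- The parametrization of the unit circle by `(0, 2π]` is a measurable embedding. -/
theorem measurableEmbedding_circleMap_Ioc :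
    MeasurableEmbedding ((Ioc (0 : ℝ) (2 * Real.pi)).domRestrict (circleMap 0 1)) :=
  (continuous_circleMap 0 1).continuousOn.measurableEmbedding measurableSet_Ioc
    (by
      have := injOn_circleMap_of_abs_sub_le (c := 0) (a := 0) (b := 2 * Real.pi) (R := 1)
        one_ne_zero (by simp [abs_of_pos Real.pi_pos])
      rwa [uIoc_of_le Real.two_pi_pos.le] at this)

/-- Pushing forward along an embedding transfers integrals and almost-everywhere statements with no
measurability condition on the integrand or the predicate. -/
theorem circleSigma_eq_map : circleSigma = (ENNReal.ofReal (2 * Real.pi))⁻¹ •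
    Measure.map ((Ioc (0 : ℝ) (2 * Real.pi)).domRestrict (circleMap 0 1))
      (Measure.comap ((↑) : Ioc (0 : ℝ) (2 * Real.pi) → ℝ) volume) := by
  rw [circleSigma, ← map_comap_subtype_coe measurableSet_Ioc, Measure.map_map
    (continuous_circleMap 0 1).measurable measurable_subtype_coe]
  rfl

theorem ae_circleSigma_of_ae_angle {P : ℂ → Prop} (h : ∀ᵐ θ : ℝ, P (circleMap 0 1 θ)) :
    ∀ᵐ z ∂circleSigma, P z := by
  rw [circleSigma_eq_map]
  refine Measure.ae_smul_measure ?_ _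
  rw [measurableEmbedding_circleMap_Ioc.ae_map_iff]
  exact (ae_restrict_iff_subtype (μ := volume) (p := fun θ => P (circleMap 0 1 θ))
    measurableSet_Ioc).1 (ae_restrict_of_ae h)

theorem ae_circleSigma_norm_eq_one : ∀ᵐ z ∂circleSigma, ‖z‖ = 1 :=
  ae_circleSigma_of_ae_angle (Eventually.of_forall fun θ => by simp [circleMap])

instance isProbabilityMeasure_circleSigma : IsProbabilityMeasure circleSigma := by
  constructor
  rw [circleSigma, Measure.smul_apply, Measure.map_apply (continuous_circleMap 0 1).measurable
    MeasurableSet.univ]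
  simp only [preimage_univ, Measure.restrict_apply_univ, Real.volume_Ioc, sub_zero, smul_eq_mul]
  exact ENNReal.inv_mul_cancel (by simp [Real.pi_pos]) ENNReal.ofReal_ne_top

theorem integral_circleSigma {E : Type*} [NormedAddCommGroup E] [NormedSpace ℝ E] (f : ℂ → E) :
    ∫ z, f z ∂circleSigma = Real.circleAverage f 0 1 := by
  rw [circleSigma_eq_map, integral_smul_measure, measurableEmbedding_circleMap_Ioc.integral_map,
    Real.circleAverage_def, intervalIntegral.integral_of_le Real.two_pi_pos.le,
    ← integral_subtype_comap measurableSet_Ioc (fun θ => f (circleMap 0 1 θ)),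
    ENNReal.toReal_inv, ENNReal.toReal_ofReal Real.two_pi_pos.le]
  rfl

/-- On the circle conjugation is inversion, so the product collapses to a power of `z` or the
conjugate of one, whose mean is its value at `0`. -/
theorem integral_circleSigma_pow_mul_conj_pow (j k : ℕ) :
    ∫ z, z ^ j * (starRingEnd ℂ) z ^ k ∂circleSigma = if j = k then 1 else 0 := by
  have key : ∀ m : ℕ, ∫ z, z ^ m ∂circleSigma = if m = 0 then 1 else 0 := by
    intro m
    rw [integral_circleSigma, DiffContOnCl.circleAverage (f := fun z : ℂ => z ^ m)
      (Differentiable.diffContOnCl (by fun_prop))]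
    simp [zero_pow_eq]
  have split : ∀ a b : ℕ, ∀ z : ℂ, ‖z‖ = 1 →
      z ^ (a + b) * (starRingEnd ℂ) z ^ a = z ^ b := by
    intro a b z hz
    have : z * (starRingEnd ℂ) z = 1 := by rw [Complex.mul_conj', hz]; simp
    rw [pow_add, mul_right_comm, ← mul_pow, this, one_pow, one_mul]
  rcases le_total k j with h | h
  · obtain ⟨m, rfl⟩ := Nat.exists_eq_add_of_le h
    rw [integral_congr_ae (g := fun z => z ^ m)
      (ae_circleSigma_norm_eq_one.mono fun z hz => split k m z hz), key]
    simp
  · obtain ⟨m, rfl⟩ := Nat.exists_eq_add_of_le h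
    rw [integral_congr_ae (g := fun z => (starRingEnd ℂ) (z ^ m))
      (ae_circleSigma_norm_eq_one.mono fun z hz => ?_), integral_conj, key]
    · by_cases hm : m = 0 <;> simp [hm]
    · have := congrArg (starRingEnd ℂ) (split j m z hz)
      simp only [map_mul, map_pow, Complex.conj_conj] at this
      simp only [map_pow, ← this, mul_comm]

theorem summable_mul_pow_of_norm_eq_one {b : ℕ → ℂ} (hb : Summable fun k => ‖b k‖) {z : ℂ}
    (hz : ‖z‖ = 1) : Summable fun k => b k * z ^ k :=
  Summable.of_norm (by simpa [hz] using hb)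

theorem aestronglyMeasurable_tsum_circle {b : ℕ → ℂ} (hb : Summable fun k => ‖b k‖) :
    AEStronglyMeasurable (fun z => ∑' k, b k * z ^ k) circleSigma := by
  refine aestronglyMeasurable_of_tendsto_ae atTop
    (f := fun (n : ℕ) (z : ℂ) => ∑ k ∈ Finset.range n, b k * z ^ k) (fun n => ?_) ?_
  · exact Continuous.aestronglyMeasurable (by fun_prop)
  · filter_upwards [ae_circleSigma_norm_eq_one] with z hz
    exact (summable_mul_pow_of_norm_eq_one hb hz).hasSum.tendsto_sum_nat

theorem norm_tsum_circle_le {b : ℕ → ℂ} (hb : Summable fun k => ‖b k‖) {z : ℂ} (hz : ‖z‖ = 1) :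
    ‖∑' k, b k * z ^ k‖ ≤ ∑' k, ‖b k‖ := by
  refine (norm_tsum_le_tsum_norm (by simpa [hz] using hb)).trans (le_of_eq ?_)
  simp [hz]

/-- Serves Parseval's identity twice: with `g` a conjugate power it extracts the coefficients of the
sum `S`, and with `g` the conjugate of `S` it expands `∫ |S|²`. -/
theorem hasSum_integral_mul_circle {b : ℕ → ℂ} (hb : Summable fun k => ‖b k‖) {g : ℂ → ℂ}
    (hg : AEStronglyMeasurable g circleSigma) {M : ℝ} (hM : ∀ z, ‖z‖ = 1 → ‖g z‖ ≤ M) :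
    HasSum (fun k => b k * ∫ z, z ^ k * g z ∂circleSigma)
      (∫ z, (∑' k, b k * z ^ k) * g z ∂circleSigma) := by
  simp_rw [← integral_const_mul, ← mul_assoc]
  refine hasSum_integral_of_dominated_convergence (fun k _ => ‖b k‖ * M) (fun k => ?_)
    (fun k => ?_) ?_ ?_ ?_
  · exact (Continuous.aestronglyMeasurable (by fun_prop)).mul hg
  · filter_upwards [ae_circleSigma_norm_eq_one] with z hz
    rw [norm_mul, norm_mul, norm_pow, hz, one_pow, mul_one]
    gcongr
    exact hM z hz
  · exact Eventually.of_forall fun _ => hb.mul_right M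
  · exact integrable_const _
  · filter_upwards [ae_circleSigma_norm_eq_one] with z hz
    exact (summable_mul_pow_of_norm_eq_one hb hz).hasSum.mul_right _

/-- Parseval's identity for absolutely convergent power series on the unit circle. -/
theorem hasSum_norm_sq_circle {b : ℕ → ℂ} (hb : Summable fun k => ‖b k‖) :
    HasSum (fun k => ‖b k‖ ^ 2) (∫ z, ‖∑' k, b k * z ^ k‖ ^ 2 ∂circleSigma) := by
  set S : ℂ → ℂ := fun z => ∑' k, b k * z ^ k with hS
  have hSm := aestronglyMeasurable_tsum_circle hb
  have hcoef : ∀ k, ∫ z, z ^ k * (starRingEnd ℂ) (S z) ∂circleSigma = (starRingEnd ℂ) (b k) := by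
    intro k
    have h := hasSum_integral_mul_circle hb (g := fun z => (starRingEnd ℂ) z ^ k)
      (Continuous.aestronglyMeasurable (by fun_prop)) (M := 1) (fun z hz => by simp [hz])
    simp_rw [integral_circleSigma_pow_mul_conj_pow] at h
    have h' := h.unique (hasSum_single k (fun j hj => by simp [hj]))
    have h2 := congrArg (starRingEnd ℂ) h'
    rw [← integral_conj] at h2
    simpa [mul_comm] using h2
  have h := hasSum_integral_mul_circle hb (g := fun z => (starRingEnd ℂ) (S z))
    (Complex.continuous_conj.comp_aestronglyMeasurable hSm) (M := ∑' k, ‖b k‖)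
    (fun z hz => by simpa using norm_tsum_circle_le hb hz)
  simp_rw [hcoef] at h
  have e1 : ∀ w : ℂ, w * (starRingEnd ℂ) w = ((‖w‖ ^ 2 : ℝ) : ℂ) := fun w => by
    rw [Complex.mul_conj']; simp
  simp_rw [e1] at h
  have e2 : ∫ z, S z * (starRingEnd ℂ) (S z) ∂circleSigma
      = ((∫ z, ‖S z‖ ^ 2 ∂circleSigma : ℝ) : ℂ) := by
    refine Eq.trans ?_ (integral_ofReal (𝕜 := ℂ))
    exact integral_congr_ae (Eventually.of_forall fun z => e1 _)
  exact Complex.hasSum_ofReal.1 (e2 ▸ h)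

/-! ### Coefficients, values and quadratic means in `H²` -/

namespace HardyTwo

theorem hasSum_norm_sq (f : HardyTwo) : HasSum (fun k => ‖f k‖ ^ 2) (‖f‖ ^ 2) := by
  have := lp.hasSum_norm (p := 2) (by norm_num) f
  simpa using this

/-- The element of `H²` with a given square summable sequence of coefficients. -/
noncomputable def mk (a : ℕ → ℂ) (ha : Summable fun k => ‖a k‖ ^ 2) : HardyTwo :=
  ⟨a, memℓp_gen (by simpa using ha)⟩

@[simp] theorem mk_apply (a : ℕ → ℂ) (ha : Summable fun k => ‖a k‖ ^ 2) (k : ℕ) :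
    mk a ha k = a k := rfl

theorem norm_coeff_le (f : HardyTwo) (k : ℕ) : ‖f k‖ ≤ ‖f‖ :=
  lp.norm_apply_le_norm (by norm_num) f k

theorem summable_norm_coeff_mul_pow (f : HardyTwo) {t : ℝ} (h0 : 0 ≤ t) (h1 : t < 1) :
    Summable fun k => ‖f k‖ * t ^ k := by
  refine Summable.of_nonneg_of_le (fun k => by positivity) (fun k => ?_)
    ((summable_geometric_of_lt_one h0 h1).mul_left ‖f‖)
  gcongr
  exact f.norm_coeff_le k

theorem hasSum_eval (f : HardyTwo) {z : ℂ} (hz : ‖z‖ < 1) :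
    HasSum (fun k => f k * z ^ k) (f.eval z) := by
  refine (Summable.of_norm ?_).hasSum
  simpa using f.summable_norm_coeff_mul_pow (norm_nonneg z) hz

theorem eval_add (f g : HardyTwo) {z : ℂ} (hz : ‖z‖ < 1) :
    (f + g).eval z = f.eval z + g.eval z := by
  refine ((f + g).hasSum_eval hz).unique ?_
  simpa [add_mul] using (f.hasSum_eval hz).add (g.hasSum_eval hz)

theorem eval_smul (c : ℂ) (f : HardyTwo) (z : ℂ) : (c • f).eval z = c * f.eval z := by
  simp [eval, mul_assoc, tsum_mul_left]

theorem eval_sub (f g : HardyTwo) {z : ℂ} (hz : ‖z‖ < 1) :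
    (f - g).eval z = f.eval z - g.eval z := by
  refine ((f - g).hasSum_eval hz).unique ?_
  simpa [sub_mul] using (f.hasSum_eval hz).sub (g.hasSum_eval hz)

theorem differentiableOn_eval (f : HardyTwo) : DifferentiableOn ℂ f.eval (ball 0 1) := by
  intro z hz
  rw [mem_ball_zero_iff] at hz
  obtain ⟨r, hzr, hr⟩ := exists_between hz
  have h := Complex.differentiableOn_tsum_of_summable_norm
    (f.summable_norm_coeff_mul_pow ((norm_nonneg z).trans hzr.le) hr)
    (F := fun k w => f k * w ^ k) (U := ball 0 r) (fun k => by fun_prop) isOpen_ball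
    (fun k w hw => by
      rw [mem_ball_zero_iff] at hw
      rw [norm_mul, norm_pow]
      gcongr)
  exact (h.differentiableAt (isOpen_ball.mem_nhds (by simpa using hzr))).differentiableWithinAt

theorem hasSum_norm_sq_circle (f : HardyTwo) {t : ℝ} (h0 : 0 ≤ t) (h1 : t < 1) :
    HasSum (fun k => ‖f k‖ ^ 2 * (t ^ 2) ^ k) (∫ z, ‖f.eval (t * z)‖ ^ 2 ∂circleSigma) := by
  have h := _root_.hasSum_norm_sq_circle (b := fun k => f k * (t : ℂ) ^ k)
    (by simpa [abs_of_nonneg h0] using f.summable_norm_coeff_mul_pow h0 h1)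
  simpa [mul_pow, eval, mul_assoc, abs_of_nonneg h0, ← pow_mul, mul_comm] using h

theorem eq_zero_of_eval_eq_zero {f : HardyTwo} (h : ∀ z ∈ ball (0 : ℂ) 1, f.eval z = 0) :
    f = 0 := by
  have hs := f.hasSum_norm_sq_circle (t := 1 / 2) (by norm_num) (by norm_num)
  have hi : ∫ z, ‖f.eval (((1 / 2 : ℝ) : ℂ) * z)‖ ^ 2 ∂circleSigma = 0 := by
    refine integral_eq_zero_of_ae ?_
    filter_upwards [ae_circleSigma_norm_eq_one] with z hz
    rw [h _ (by rw [mem_ball_zero_iff, norm_mul, hz]; norm_num)]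
    simp
  rw [hi, hasSum_zero_iff_of_nonneg (fun k => by positivity)] at hs
  ext k
  have := congrFun hs k
  simpa using this

theorem ext_of_eval {f g : HardyTwo} (h : ∀ z ∈ ball (0 : ℂ) 1, f.eval z = g.eval z) : f = g := by
  rw [← sub_eq_zero]
  refine eq_zero_of_eval_eq_zero fun z hz => ?_
  rw [eval_sub _ _ (by simpa using hz), h z hz, sub_self]

/-- An analytic function on the disc whose quadratic means over circles are bounded is in `H²`. -/
theorem exists_of_integral_le {F : ℂ → ℂ} (hF : DifferentiableOn ℂ F (ball 0 1)) {M : ℝ}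
    (hM : ∀ t : ℝ, 0 ≤ t → t < 1 → ∫ z, ‖F (t * z)‖ ^ 2 ∂circleSigma ≤ M) :
    ∃ f : HardyTwo, (∀ z ∈ ball (0 : ℂ) 1, f.eval z = F z) ∧ ‖f‖ ^ 2 ≤ M := by
  obtain ⟨a, ha⟩ : ∃ a : ℕ → ℂ, ∀ z ∈ ball (0 : ℂ) 1, HasSum (fun k => a k * z ^ k) (F z) := by
    refine ⟨fun k => (k.factorial : ℂ)⁻¹ * iteratedDeriv k F 0, fun z hz => ?_⟩
    have := Complex.hasSum_taylorSeries_on_ball (c := 0) (r := 1) (by simpa using hF)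
      (z := z) (by simpa using hz)
    simpa [mul_comm, mul_assoc, mul_left_comm] using this
  have key : ∀ t : ℝ, 0 ≤ t → t < 1 → ∀ N : ℕ,
      ∑ k ∈ Finset.range N, ‖a k‖ ^ 2 * (t ^ 2) ^ k ≤ M := by
    intro t h0 h1 N
    have hsum : Summable fun k => ‖a k * (t : ℂ) ^ k‖ :=
      (ha t (by simpa [abs_of_nonneg h0] using h1)).summable.norm
    have h := _root_.hasSum_norm_sq_circle hsum
    have e : ∫ z, ‖∑' k, a k * (t : ℂ) ^ k * z ^ k‖ ^ 2 ∂circleSigma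
        = ∫ z, ‖F (t * z)‖ ^ 2 ∂circleSigma := by
      refine integral_congr_ae ?_
      filter_upwards [ae_circleSigma_norm_eq_one] with z hz
      have := (ha (t * z) (by simpa [hz, abs_of_nonneg h0] using h1)).tsum_eq
      simp only [mul_pow, ← mul_assoc] at this
      simp only [this]
    rw [e] at h
    refine le_trans ?_ (hM t h0 h1)
    refine le_trans (le_of_eq ?_) (sum_le_hasSum (Finset.range N) (fun k _ => by positivity) h)
    refine Finset.sum_congr rfl fun k _ => ?_
    simp [mul_pow, abs_of_nonneg h0, ← pow_mul, mul_comm]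
  -- A partial sum is a polynomial in `t`, so `t → 1` needs no convergence theorem.
  have key1 : ∀ N : ℕ, ∑ k ∈ Finset.range N, ‖a k‖ ^ 2 ≤ M := by
    intro N
    have hc : Tendsto (fun t : ℝ => ∑ k ∈ Finset.range N, ‖a k‖ ^ 2 * (t ^ 2) ^ k) (𝓝[<] 1)
        (𝓝 (∑ k ∈ Finset.range N, ‖a k‖ ^ 2 * ((1 : ℝ) ^ 2) ^ k)) :=
      Continuous.tendsto (f := fun t : ℝ => ∑ k ∈ Finset.range N, ‖a k‖ ^ 2 * (t ^ 2) ^ k)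
        (by fun_prop) 1 |>.mono_left nhdsWithin_le_nhds
    have := le_of_tendsto hc (b := M) (by
      filter_upwards [Ioo_mem_nhdsLT (zero_lt_one' ℝ)] with t ht
      exact key t ht.1.le ht.2 N)
    simpa using this
  have hsq : Summable fun k => ‖a k‖ ^ 2 :=
    summable_of_sum_range_le (fun k => by positivity) key1
  refine ⟨mk a hsq, fun z hz => (ha z hz).tsum_eq, ?_⟩
  exact le_of_tendsto (mk a hsq).hasSum_norm_sq.tendsto_sum_nat
    (Eventually.of_forall key1)

/-! ### Harmonic majorants and boundedness of the composition operator -/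

/-- The backward shift on `H²`. -/
noncomputable def backwardShift : HardyTwo →L[ℂ] HardyTwo :=
  LinearMap.mkContinuous
    { toFun := fun f => mk (fun k => f (k + 1))
        ((summable_nat_add_iff 1).2 f.hasSum_norm_sq.summable)
      map_add' := fun f g => by ext k; simp
      map_smul' := fun c f => by ext k; simp } 1 (fun f => by
    rw [one_mul, ← sq_le_sq₀ (norm_nonneg _) (norm_nonneg _)]
    have h := (hasSum_nat_add_iff' 1).2 f.hasSum_norm_sq
    have h' := hasSum_norm_sq (mk (fun k => f (k + 1))
      ((summable_nat_add_iff 1).2 f.hasSum_norm_sq.summable))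
    have := h'.unique h
    simp only [LinearMap.coe_mk, AddHom.coe_mk, this]
    simp)

@[simp] theorem backwardShift_apply (f : HardyTwo) (k : ℕ) :
    backwardShift f k = f (k + 1) := rfl

theorem norm_backwardShift_sq (f : HardyTwo) :
    ‖backwardShift f‖ ^ 2 = ‖f‖ ^ 2 - ‖f 0‖ ^ 2 := by
  have h := (hasSum_nat_add_iff' 1).2 f.hasSum_norm_sq
  simpa using (backwardShift f).hasSum_norm_sq.unique h

theorem norm_backwardShift_le (f : HardyTwo) : ‖backwardShift f‖ ≤ ‖f‖ := by
  rw [← sq_le_sq₀ (norm_nonneg _) (norm_nonneg _), norm_backwardShift_sq]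
  simp

theorem norm_smul_backwardShift_lt_one {w : ℂ} (hw : ‖w‖ < 1) :
    ‖w • backwardShift‖ < 1 := by
  refine lt_of_le_of_lt ?_ hw
  rw [norm_smul]
  refine mul_le_of_le_one_right (norm_nonneg w) ?_
  exact ContinuousLinearMap.opNorm_le_bound _ zero_le_one
    fun f => by simpa using norm_backwardShift_le f

/-- Iterating `g k = f k + w * g (k + 1)` from `k = 0` produces the power series of `f` at `w`, with
a remainder `w ^ N * g N` tending to `0`. -/
theorem coeff_zero_of_eq_add_backwardShift {f g : HardyTwo} {w : ℂ} (hw : ‖w‖ < 1)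
    (h : g = f + w • backwardShift g) : g 0 = f.eval w := by
  have hk : ∀ k, g k = f k + w * g (k + 1) := fun k => by
    have := congrArg (fun u : HardyTwo => u k) h
    rwa [lp.coeFn_add, Pi.add_apply, lp.coeFn_smul, Pi.smul_apply, smul_eq_mul,
      backwardShift_apply] at this
  have hN : ∀ N : ℕ, ∑ k ∈ Finset.range N, f k * w ^ k = g 0 - w ^ N * g N := by
    intro N
    induction N with
    | zero => simp
    | succ N ih => rw [Finset.sum_range_succ, ih, hk N]; ring
  have hlim : Tendsto (fun N : ℕ => g 0 - w ^ N * g N) atTop (𝓝 (g 0 - 0)) := by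
    refine tendsto_const_nhds.sub ?_
    refine squeeze_zero_norm (a := fun N => ‖w‖ ^ N * ‖g‖) (fun N => ?_) ?_
    · rw [norm_mul, norm_pow]
      gcongr
      exact g.norm_coeff_le N
    · simpa using (tendsto_pow_atTop_nhds_zero_of_lt_one (norm_nonneg w) hw).mul_const ‖g‖
  have h2 := (f.hasSum_eval hw).tendsto_sum_nat
  simp_rw [hN] at h2
  simpa using tendsto_nhds_unique hlim h2

open scoped InnerProductSpace in
/-- `|f|²` has a harmonic majorant in the disc: the real part of
`w ↦ ⟪f, (1 + wL)(1 - wL)⁻¹ f⟫`, where `L` is the backward shift. -/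
theorem exists_analytic_majorant (f : HardyTwo) : ∃ h : ℂ → ℂ, DifferentiableOn ℂ h (ball 0 1) ∧
    ∀ w ∈ ball (0 : ℂ) 1, ‖f.eval w‖ ^ 2 ≤ (h w).re ∧
      (h w).re ≤ (1 + ‖w‖) / (1 - ‖w‖) * ‖f‖ ^ 2 := by
  set R : ℂ → (HardyTwo →L[ℂ] HardyTwo) := fun w => Ring.inverse (1 - w • backwardShift) with hR
  have hu : ∀ w ∈ ball (0 : ℂ) 1, IsUnit (1 - w • backwardShift) := fun w hw =>
    (Units.oneSub _ (norm_smul_backwardShift_lt_one (by simpa using hw))).isUnit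
  refine ⟨fun w => ⟪f, (1 + w • backwardShift) (R w f)⟫_ℂ, ?_, ?_⟩
  · intro w hw
    have hRd : DifferentiableAt ℂ R w := by
      have h1 : DifferentiableAt ℂ Ring.inverse (1 - w • backwardShift) :=
        differentiableAt_inverse (𝕜 := ℂ) (hu w hw)
      have h2 : DifferentiableAt ℂ (fun w : ℂ => 1 - w • backwardShift) w := by fun_prop
      exact h1.comp w h2
    have h2 : DifferentiableAt ℂ (fun w => (1 + w • backwardShift) (R w f)) w := by fun_prop
    exact ((innerSL ℂ f).differentiableAt.comp w h2).differentiableWithinAt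
  · intro w hw
    have hw1 : ‖w‖ < 1 := by simpa using hw
    set g := R w f with hg
    have hfg : f = g - w • backwardShift g := by
      have := congrArg (fun T : HardyTwo →L[ℂ] HardyTwo => T f) (Ring.mul_inverse_cancel _ (hu w hw))
      simpa [hg, hR] using this.symm
    have hg' : g = f + w • backwardShift g := by rw [hfg]; simp
    have h0 := coeff_zero_of_eq_add_backwardShift hw1 hg'
    set v := w • backwardShift g with hv
    have hvg : ‖v‖ ≤ ‖w‖ * ‖g‖ := by
      rw [hv, norm_smul]; gcongr; exact norm_backwardShift_le g
    have happ : (1 + w • backwardShift) g = g + v := by simp [hv]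
    beta_reduce
    rw [← hg, happ]
    constructor
    · have e : (⟪f, g + v⟫_ℂ).re = ‖g‖ ^ 2 - ‖v‖ ^ 2 := by
        rw [hfg, inner_sub_left, inner_add_right, inner_add_right]
        have e1 : (⟪g, g⟫_ℂ).re = ‖g‖ ^ 2 := inner_self_eq_norm_sq (𝕜 := ℂ) g
        have e2 : (⟪v, v⟫_ℂ).re = ‖v‖ ^ 2 := inner_self_eq_norm_sq (𝕜 := ℂ) v
        have e3 : (⟪g, v⟫_ℂ).re = (⟪v, g⟫_ℂ).re := inner_re_symm (𝕜 := ℂ) g v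
        simp only [Complex.sub_re, Complex.add_re, e1, e2, e3]
        ring
      -- The real part becomes `(1 - ‖w‖²) ‖g‖² + ‖w‖² ‖g 0‖²`, a convex combination that is at
      -- least `‖g 0‖² = ‖f.eval w‖²`.
      have hv2 : ‖v‖ ^ 2 = ‖w‖ ^ 2 * (‖g‖ ^ 2 - ‖g 0‖ ^ 2) := by
        rw [hv, norm_smul, mul_pow, norm_backwardShift_sq]
      have hg0 : ‖g 0‖ ^ 2 ≤ ‖g‖ ^ 2 := by
        gcongr; exact g.norm_coeff_le 0
      rw [e, hv2, ← h0]
      have : ‖w‖ ^ 2 ≤ 1 := pow_le_one₀ (norm_nonneg w) hw1.le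
      nlinarith
    · have h1 : (⟪f, g + v⟫_ℂ).re ≤ ‖f‖ * ‖g + v‖ :=
        (Complex.re_le_norm _).trans (norm_inner_le_norm f (g + v))
      have h2 : ‖g + v‖ ≤ (1 + ‖w‖) * ‖g‖ := by
        refine (norm_add_le g v).trans ?_; linarith
      have h3 : ‖g‖ ≤ ‖f‖ / (1 - ‖w‖) := by
        rw [le_div_iff₀ (by linarith)]
        have := norm_add_le f v
        rw [← hg'] at this
        linarith
      refine h1.trans ?_
      calc ‖f‖ * ‖g + v‖ ≤ ‖f‖ * ((1 + ‖w‖) * (‖f‖ / (1 - ‖w‖))) := by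
            gcongr; exact h2.trans (by gcongr)
        _ = _ := by ring

/-- Littlewood's subordination: the majorant composed with `φ` has mean `Re h (φ 0)` over every
circle of radius `t < 1`. -/
theorem integral_norm_eval_comp_sq_le {φ : ℂ → ℂ} (hφ : DifferentiableOn ℂ φ (ball 0 1))
    (hmaps : MapsTo φ (ball 0 1) (ball 0 1)) (f : HardyTwo) {t : ℝ} (h0 : 0 ≤ t) (h1 : t < 1) :
    ∫ z, ‖f.eval (φ (t * z))‖ ^ 2 ∂circleSigma
      ≤ (1 + ‖φ 0‖) / (1 - ‖φ 0‖) * ‖f‖ ^ 2 := by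
  obtain ⟨h, hd, hb⟩ := f.exists_analytic_majorant
  have hφ0 : φ 0 ∈ ball (0 : ℂ) 1 := hmaps (by simp)
  refine le_trans ?_ (hb _ hφ0).2
  have hcomp : DifferentiableOn ℂ (fun z : ℂ => h (φ (t * z))) (closedBall 0 1) := by
    refine hd.comp (hφ.comp (by fun_prop) ?_) ?_
    all_goals
      intro z hz
      have : (t : ℂ) * z ∈ ball (0 : ℂ) 1 := by
        rw [mem_closedBall_zero_iff] at hz
        rw [mem_ball_zero_iff, norm_mul, Complex.norm_real, Real.norm_of_nonneg h0]
        nlinarith [norm_nonneg z]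
      first
        | exact this
        | exact hmaps this
  have hcont : ContinuousOn (fun z : ℂ => h (φ (t * z))) (closedBall 0 1) := hcomp.continuousOn
  have hmem : ∀ z : ℂ, ‖z‖ = 1 → φ (t * z) ∈ ball (0 : ℂ) 1 := fun z hz =>
    hmaps (by simpa [hz, abs_of_nonneg h0] using h1)
  have hci : CircleIntegrable (fun z : ℂ => h (φ (t * z))) 0 1 :=
    (hcont.mono sphere_subset_closedBall).circleIntegrable zero_le_one
  have hmean : Real.circleAverage (fun z : ℂ => h (φ (t * z))) 0 1 = h (φ 0) := by
    rw [DiffContOnCl.circleAverage]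
    · simp
    · rw [abs_one]
      exact ⟨hcomp.mono ball_subset_closedBall, by rwa [closure_ball _ one_ne_zero]⟩
  rw [integral_circleSigma]
  have hre : Real.circleAverage (fun z : ℂ => (h (φ (t * z))).re) 0 1 = (h (φ 0)).re := by
    rw [← hmean]
    exact Complex.reCLM.circleAverage_comp_comm hci
  rw [← hre]
  refine Real.circleAverage_mono ?_ ?_ ?_
  · refine ContinuousOn.circleIntegrable zero_le_one ?_
    refine (ContinuousOn.norm ?_).pow 2
    refine f.differentiableOn_eval.continuousOn.comp (hφ.continuousOn.comp (by fun_prop) ?_) ?_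
    · intro z hz
      simpa [mem_sphere_zero_iff_norm.1 hz, abs_of_nonneg h0] using h1
    · intro z hz
      exact hmem z (mem_sphere_zero_iff_norm.1 hz)
  · exact ContinuousOn.circleIntegrable zero_le_one
      (Complex.continuous_re.comp_continuousOn (hcont.mono sphere_subset_closedBall))
  · intro z hz
    exact (hb _ (hmem z (by simpa using hz))).1

end HardyTwo

theorem existsUnique_isCompositionOperator {φ : ℂ → ℂ} (hφ : DifferentiableOn ℂ φ (ball 0 1))
    (hmaps : MapsTo φ (ball 0 1) (ball 0 1)) :
    ∃! C : HardyTwo →L[ℂ] HardyTwo, IsCompositionOperator φ C := by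
  have hex : ∀ f : HardyTwo, ∃ g : HardyTwo, (∀ z ∈ ball (0 : ℂ) 1, g.eval z = f.eval (φ z)) ∧
      ‖g‖ ^ 2 ≤ (1 + ‖φ 0‖) / (1 - ‖φ 0‖) * ‖f‖ ^ 2 := fun f =>
    HardyTwo.exists_of_integral_le (f.differentiableOn_eval.comp hφ hmaps)
      fun t h0 h1 => f.integral_norm_eval_comp_sq_le hφ hmaps h0 h1
  choose T hT hTn using hex
  have hφ1 : ∀ z ∈ ball (0 : ℂ) 1, ‖φ z‖ < 1 := fun z hz => by simpa using hmaps hz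
  refine ⟨LinearMap.mkContinuous
    { toFun := T
      map_add' := fun f g => HardyTwo.ext_of_eval fun z hz => ?_
      map_smul' := fun c f => HardyTwo.ext_of_eval fun z hz => ?_ }
    (Real.sqrt ((1 + ‖φ 0‖) / (1 - ‖φ 0‖))) fun f => ?_, fun f z hz => hT f z hz, ?_⟩
  · rw [hT _ z hz, HardyTwo.eval_add _ _ (hφ1 z hz), HardyTwo.eval_add _ _ (by simpa using hz),
      hT _ z hz, hT _ z hz]
  · rw [hT _ z hz, RingHom.id_apply, HardyTwo.eval_smul, HardyTwo.eval_smul, hT _ z hz]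
  · have : ‖T f‖ ≤ Real.sqrt ((1 + ‖φ 0‖) / (1 - ‖φ 0‖) * ‖f‖ ^ 2) := Real.le_sqrt_of_sq_le (hTn f)
    rwa [Real.sqrt_mul' _ (sq_nonneg _), Real.sqrt_sq (norm_nonneg f)] at this
  · intro C hC
    ext1 f
    refine HardyTwo.ext_of_eval fun z hz => ?_
    rw [hC f z hz]
    exact (hT f z hz).symm

/-! ### Fatou's theorem on radial limits -/

theorem integrable_circleSigma_of_continuousOn {E : Type*} [NormedAddCommGroup E] {f : ℂ → E}
    (hf : ContinuousOn f (sphere 0 1)) : Integrable f circleSigma := by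
  have h := hf.integrableOn_compact (isCompact_sphere 0 1) (μ := circleSigma)
  rwa [IntegrableOn, Measure.restrict_eq_self_of_ae_mem
    (ae_circleSigma_norm_eq_one.mono fun z hz => by simpa using hz)] at h

theorem sub_ne_zero_of_mem_ball_sphere {w z : ℂ} (hw : w ∈ ball (0 : ℂ) 1)
    (hz : z ∈ sphere (0 : ℂ) 1) : z - w ≠ 0 := by
  rw [sub_ne_zero]
  rintro rfl
  simp only [mem_ball_zero_iff, mem_sphere_zero_iff_norm] at hw hz
  exact hw.ne hz

theorem circleAverage_poissonKernel {w : ℂ} (hw : w ∈ ball (0 : ℂ) 1) :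
    Real.circleAverage (fun z => (1 - ‖w‖ ^ 2) / ‖z - w‖ ^ 2) 0 1 = 1 := by
  have h := DiffContOnCl.circleAverage_poissonKernel_smul' (c := 0) (R := 1) (w := w)
    (f := fun _ => (1 : ℂ)) (diffContOnCl_const) hw
  have h2 : Real.circleAverage (fun z => (((1 - ‖w‖ ^ 2) / ‖z - w‖ ^ 2 : ℝ) : ℂ)) 0 1 = 1 := by
    rw [← h]
    refine Real.circleAverage_congr_sphere fun z hz => ?_
    have : ‖z‖ = 1 := by simpa using hz
    simp [this]
  rw [← integral_circleSigma] at h2 ⊢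
  rw [integral_complex_ofReal] at h2
  exact Complex.ofReal_eq_one.1 h2

/-- Cauchy's formula for the derivative as a circle average. -/
theorem DiffContOnCl.circleAverage_div_sub_sq {f : ℂ → ℂ} (hf : DiffContOnCl ℂ f (ball 0 1))
    {w : ℂ} (hw : w ∈ ball (0 : ℂ) 1) :
    Real.circleAverage (fun z => z / (z - w) ^ 2 * f z) 0 1 = deriv f w := by
  have hfc : ContinuousOn f (sphere 0 1) := hf.continuousOn_ball.mono sphere_subset_closedBall
  have hfi : CircleIntegrable f 0 1 := hfc.circleIntegrable zero_le_one
  -- Since `(ζ + u)/(ζ - u) = 2ζ/(ζ - u) - 1`, Cauchy's formula and the mean value property combine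
  -- into this representation; differentiating it in `u` gives twice the claim.
  have hrep : ∀ u ∈ ball (0 : ℂ) 1,
      Real.circleAverage (fun ζ => herglotzRieszKernel 0 u ζ • f ζ) 0 1 = 2 * f u - f 0 := by
    intro u hu
    have h1 := DiffContOnCl.circleAverage_smul_div (c := 0) (R := 1) (f := f) (w := u)
      (by simpa using hf) (by simpa using hu)
    have h2 := DiffContOnCl.circleAverage (c := 0) (R := 1) (f := f) (by simpa using hf)
    have hi : CircleIntegrable (fun z => ((z - 0) / (z - u)) • f z) 0 1 := by
      refine ContinuousOn.circleIntegrable zero_le_one ?_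
      exact (ContinuousOn.div (by fun_prop) (by fun_prop)
        fun z hz => sub_ne_zero_of_mem_ball_sphere hu hz).smul hfc
    rw [← h1, ← h2, two_mul, ← Real.circleAverage_add hi hi,
      ← Real.circleAverage_sub (hi.add hi) hfi]
    refine Real.circleAverage_congr_sphere fun z hz => ?_
    have hz' := sub_ne_zero_of_mem_ball_sphere hu (by simpa using hz)
    simp only [herglotzRieszKernel_def, sub_zero, smul_eq_mul, Pi.sub_apply, Pi.add_apply]
    field_simp
    ring
  have hd := hasDerivAt_circleAverage_herglotzRieszKernel_smul hfi hw
  have hd2 : HasDerivAt (fun u => 2 * f u - f 0) (2 * deriv f w) w :=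
    (((hf.differentiableAt isOpen_ball hw).hasDerivAt).const_mul 2).sub_const (f 0)
  have hd3 := hd2.congr_of_eventuallyEq (f₁ := fun u =>
    Real.circleAverage (fun ζ => herglotzRieszKernel 0 u ζ • f ζ) 0 1) (by
      filter_upwards [isOpen_ball.mem_nhds hw] with u hu using hrep u hu)
  have h4 := hd.unique hd3
  have h5 : Real.circleAverage (fun ζ => (2 * ζ / (ζ - w) ^ 2) • f ζ) 0 1
      = 2 * Real.circleAverage (fun z => z / (z - w) ^ 2 * f z) 0 1 := by
    rw [← smul_eq_mul, ← Real.circleAverage_fun_smul]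
    refine Real.circleAverage_congr_sphere fun z _ => ?_
    simp only [smul_eq_mul]
    ring
  rw [h5] at h4
  exact mul_left_cancel₀ two_ne_zero h4

theorem norm_sub_ofReal_mul_comm {z ζ : ℂ} (hz : ‖z‖ = 1) (hζ : ‖ζ‖ = 1) (r : ℝ) :
    ‖ζ - r * z‖ = ‖z - r * ζ‖ := by
  have h1 : z * (starRingEnd ℂ) z = 1 := by rw [Complex.mul_conj', hz]; simp
  have h2 : ζ * (starRingEnd ℂ) ζ = 1 := by rw [Complex.mul_conj', hζ]; simp
  have : ζ - r * z = ζ * z * (starRingEnd ℂ) (z - r * ζ) := by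
    simp only [map_sub, map_mul, Complex.conj_ofReal]
    linear_combination (-ζ) * h1 + r * z * h2
  rw [this, norm_mul, norm_mul, hz, hζ, RCLike.norm_conj]
  simp

/-- The difference of the Cauchy kernel for the derivative and its reflection in the circle is
bounded by the Poisson kernel, after multiplication by the distance to the centre. -/
theorem norm_reflected_kernel_mul_le {z ζ : ℂ} (hz : ‖z‖ = 1) (hζ : ‖ζ‖ = 1) {r : ℝ}
    (h0 : 0 ≤ r) (h1 : r < 1) :
    ‖ζ / (ζ - r * z) ^ 2 - ζ / (z - r * ζ) ^ 2‖ * ‖ζ - z‖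
      ≤ 8 * ((1 - r ^ 2) / ‖ζ - r * z‖ ^ 2) := by
  have hpos : 0 < ‖ζ - r * z‖ := by
    have := norm_sub_norm_le ζ (r * z)
    rw [norm_mul, hζ, hz, Complex.norm_real, Real.norm_of_nonneg h0] at this
    linarith
  have hr2 : 0 ≤ 1 - r ^ 2 := by nlinarith
  have e := norm_sub_ofReal_mul_comm hz hζ r
  have hne : ζ - r * z ≠ 0 := norm_pos_iff.1 hpos
  have hne' : z - r * ζ ≠ 0 := norm_pos_iff.1 (e ▸ hpos)
  -- The numerator is `(z - rζ)² - (ζ - rz)² = (1 - r²)(z² - ζ²)`. The constant 8 is then `2 · 4`,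
  -- from `‖z + ζ‖ ≤ 2` and `‖ζ - z‖² ≤ 4 ‖ζ - rz‖²`.
  have hid : ζ / (ζ - r * z) ^ 2 - ζ / (z - r * ζ) ^ 2
      = ζ * ((1 - r ^ 2 : ℝ) * ((z - ζ) * (z + ζ))) / ((ζ - r * z) ^ 2 * (z - r * ζ) ^ 2) := by
    rw [div_sub_div _ _ (pow_ne_zero 2 hne) (pow_ne_zero 2 hne')]
    congr 1
    push_cast
    ring
  have hsum : ‖z + ζ‖ ≤ 2 := (norm_add_le z ζ).trans (by rw [hz, hζ]; norm_num)
  have hdist : ‖ζ - z‖ ≤ 2 * ‖ζ - r * z‖ := by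
    have h2 : ‖ζ - z‖ ≤ ‖ζ - r * z‖ + ‖(1 - r : ℝ) * z‖ := by
      have : ζ - z = (ζ - r * z) - ((1 - r : ℝ) : ℂ) * z := by push_cast; ring
      rw [this]
      simpa using norm_sub_le (ζ - r * z) (((1 - r : ℝ) : ℂ) * z)
    have h3 : 1 - r ≤ ‖ζ - r * z‖ := by
      have := norm_sub_norm_le ζ (r * z)
      rwa [norm_mul, hζ, hz, Complex.norm_real, Real.norm_of_nonneg h0, mul_one] at this
    rw [norm_mul, hz, Complex.norm_real, Real.norm_of_nonneg (by linarith)] at h2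
    linarith
  rw [hid, norm_div, norm_mul, norm_mul, norm_mul, norm_mul, norm_pow, norm_pow, hζ, ← e,
    Complex.norm_real, Real.norm_of_nonneg hr2, norm_sub_rev z ζ]
  set d := ‖ζ - r * z‖
  set s := ‖ζ - z‖
  have hs : 0 ≤ s := norm_nonneg _
  rw [div_mul_eq_mul_div, ← mul_div_assoc, div_le_div_iff₀ (by positivity) (by positivity)]
  have : s * s ≤ 4 * d ^ 2 := by nlinarith
  calc 1 * ((1 - r ^ 2) * (s * ‖z + ζ‖)) * s * d ^ 2
      = (1 - r ^ 2) * (s * s) * ‖z + ζ‖ * d ^ 2 := by ring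
    _ ≤ (1 - r ^ 2) * (4 * d ^ 2) * 2 * d ^ 2 := by gcongr
    _ = 8 * (1 - r ^ 2) * (d ^ 2 * d ^ 2) := by ring

/-- If `Φ` is differentiable along the circle at `z`, then its derivative has this radial limit. -/
theorem tendsto_deriv_radial {Φ : ℂ → ℂ} {K : NNReal} (hK : LipschitzWith K Φ)
    (hd : DifferentiableOn ℂ Φ (ball 0 1)) {z L : ℂ} (hz : ‖z‖ = 1)
    (hL : ∀ ε > 0, ∀ᶠ ζ in 𝓝[sphere 0 1] z, ‖Φ ζ - Φ z - L * (ζ - z)‖ ≤ ε * ‖ζ - z‖) :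
    Tendsto (fun r : ℝ => deriv Φ (r * z)) (𝓝[<] 1) (𝓝 L) := by
  set E : ℂ → ℂ := fun ζ => Φ ζ - Φ z - L * (ζ - z) with hE
  have hEc : Continuous E := by have := hK.continuous; fun_prop
  have hEd : DifferentiableOn ℂ E (ball 0 1) := by fun_prop
  have hEcl : DiffContOnCl ℂ E (ball 0 1) := ⟨hEd, hEc.continuousOn⟩
  set M : ℝ := K + ‖L‖ with hM
  have hM0 : 0 ≤ M := by positivity
  have hEM : ∀ ζ, ‖E ζ‖ ≤ M * ‖ζ - z‖ := by
    intro ζ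
    refine (norm_sub_le _ _).trans ?_
    rw [norm_mul, hM, add_mul]
    gcongr
    simpa [dist_eq_norm] using hK.dist_le_mul ζ z
  have hball : ∀ r : ℝ, 0 ≤ r → r < 1 → (r : ℂ) * z ∈ ball (0 : ℂ) 1 := by
    intro r h0 h1
    simpa [hz, abs_of_nonneg h0] using h1
  have hderiv : ∀ r : ℝ, 0 ≤ r → r < 1 → deriv E (r * z) = deriv Φ (r * z) - L := by
    intro r h0 h1
    have h := (hd.differentiableAt (isOpen_ball.mem_nhds (hball r h0 h1))).hasDerivAt
    have h2 : HasDerivAt (fun ζ => L * (ζ - z)) (L * 1) (r * z) :=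
      ((hasDerivAt_id _).sub_const z).const_mul L
    rw [mul_one] at h2
    exact ((h.sub_const (Φ z)).sub h2).deriv
  -- The reflected kernel `ζ / (z - rζ)²` is analytic on the closed disc and vanishes at `0`, so
  -- subtracting it does not change the average.
  have hrep : ∀ r : ℝ, 0 ≤ r → r < 1 → deriv Φ (r * z) - L = Real.circleAverage
      (fun ζ => (ζ / (ζ - r * z) ^ 2 - ζ / (z - r * ζ) ^ 2) * E ζ) 0 1 := by
    intro r h0 h1
    have hne : ∀ ζ ∈ closedBall (0 : ℂ) 1, (z - r * ζ) ^ 2 ≠ 0 := by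
      intro ζ hζ h
      have h2 : z = r * ζ := sub_eq_zero.1 (pow_eq_zero_iff two_ne_zero |>.1 h)
      have h3 := congrArg norm h2
      rw [mem_closedBall_zero_iff] at hζ
      rw [norm_mul, hz, Complex.norm_real, Real.norm_of_nonneg h0] at h3
      nlinarith [norm_nonneg ζ]
    have h2 : Real.circleAverage (fun ζ => ζ / (z - r * ζ) ^ 2 * E ζ) 0 1 = 0 := by
      rw [DiffContOnCl.circleAverage]
      · simp
      · rw [abs_one]
        refine ⟨(DifferentiableOn.div (by fun_prop) (by fun_prop) fun ζ hζ =>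
          hne ζ (ball_subset_closedBall hζ)).mul hEd, ?_⟩
        rw [closure_ball _ one_ne_zero]
        exact (ContinuousOn.div (by fun_prop) (by fun_prop) hne).mul hEc.continuousOn
    have h3 := congrArg₂ (· - ·) (hEcl.circleAverage_div_sub_sq (hball r h0 h1)) h2
    beta_reduce at h3
    rw [← hderiv r h0 h1, ← sub_zero (deriv E _), ← h3, ← Real.circleAverage_fun_sub]
    · simp only [sub_mul]
    · refine ContinuousOn.circleIntegrable zero_le_one ?_
      exact (ContinuousOn.div (by fun_prop) (by fun_prop) fun ζ hζ => pow_ne_zero 2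
        (sub_ne_zero_of_mem_ball_sphere (hball r h0 h1) hζ)).mul hEc.continuousOn
    · refine ContinuousOn.circleIntegrable zero_le_one ?_
      exact (ContinuousOn.div (by fun_prop) (by fun_prop) fun ζ hζ =>
        hne ζ (sphere_subset_closedBall hζ)).mul hEc.continuousOn
  -- Near `z` the integrand is at most `8ε` times the Poisson kernel, whose mean is 1. Away from
  -- `z`, `‖ζ - rz‖ ≥ δ/2` bounds it by `8M (1 - r²)/(δ/2)²`, whence `32 M / δ²`.
  have hbound : ∀ ε > 0, ∃ A : ℝ, ∀ r : ℝ, 0 ≤ r → r < 1 →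
      ‖deriv Φ (r * z) - L‖ ≤ 8 * ε + A * (1 - r ^ 2) := by
    intro ε hε
    obtain ⟨δ, hδ, hnear⟩ := mem_nhdsWithin_iff.1 (hL ε hε)
    refine ⟨32 * M / δ ^ 2, fun r h0 h1 => ?_⟩
    have hr2 : 0 ≤ 1 - r ^ 2 := by nlinarith
    have hsph : ∀ ζ ∈ sphere (0 : ℂ) 1, ζ - r * z ≠ 0 := fun ζ hζ =>
      sub_ne_zero_of_mem_ball_sphere (hball r h0 h1) hζ
    have hpw : ∀ ζ ∈ sphere (0 : ℂ) 1,
        ‖(ζ / (ζ - r * z) ^ 2 - ζ / (z - r * ζ) ^ 2) * E ζ‖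
          ≤ 8 * ε * ((1 - r ^ 2) / ‖ζ - r * z‖ ^ 2) + 32 * M / δ ^ 2 * (1 - r ^ 2) := by
      intro ζ hζ
      have hζ1 : ‖ζ‖ = 1 := by simpa using hζ
      have hk := norm_reflected_kernel_mul_le hz hζ1 h0 h1
      have hpos : 0 < ‖ζ - r * z‖ := norm_pos_iff.2 (hsph ζ hζ)
      rw [norm_mul]
      by_cases hnr : dist ζ z < δ
      · have hE1 : ‖E ζ‖ ≤ ε * ‖ζ - z‖ := hnear ⟨hnr, hζ⟩
        calc _ ≤ ‖ζ / (ζ - r * z) ^ 2 - ζ / (z - r * ζ) ^ 2‖ * (ε * ‖ζ - z‖) := by gcongr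
          _ = ε * (‖ζ / (ζ - r * z) ^ 2 - ζ / (z - r * ζ) ^ 2‖ * ‖ζ - z‖) := by ring
          _ ≤ ε * (8 * ((1 - r ^ 2) / ‖ζ - r * z‖ ^ 2)) := by gcongr
          _ ≤ _ := by
            have : 0 ≤ 32 * M / δ ^ 2 * (1 - r ^ 2) := by positivity
            linarith
      · have hfar : δ ≤ 2 * ‖ζ - r * z‖ := by
          have h2 : ‖ζ - z‖ ≤ ‖ζ - r * z‖ + ‖((1 - r : ℝ) : ℂ) * z‖ := by
            have : ζ - z = (ζ - r * z) - ((1 - r : ℝ) : ℂ) * z := by push_cast; ring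
            rw [this]
            exact norm_sub_le (ζ - r * z) (((1 - r : ℝ) : ℂ) * z)
          have h3 : 1 - r ≤ ‖ζ - r * z‖ := by
            have := norm_sub_norm_le ζ (r * z)
            rwa [norm_mul, hζ1, hz, Complex.norm_real, Real.norm_of_nonneg h0, mul_one] at this
          rw [norm_mul, hz, Complex.norm_real, Real.norm_of_nonneg (by linarith)] at h2
          rw [dist_eq_norm] at hnr
          linarith
        calc _ ≤ ‖ζ / (ζ - r * z) ^ 2 - ζ / (z - r * ζ) ^ 2‖ * (M * ‖ζ - z‖) := by
              gcongr; exact hEM ζ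
          _ = M * (‖ζ / (ζ - r * z) ^ 2 - ζ / (z - r * ζ) ^ 2‖ * ‖ζ - z‖) := by ring
          _ ≤ M * (8 * ((1 - r ^ 2) / ‖ζ - r * z‖ ^ 2)) := by gcongr
          _ ≤ M * (8 * ((1 - r ^ 2) / (δ / 2) ^ 2)) := by gcongr; linarith
          _ = 32 * M / δ ^ 2 * (1 - r ^ 2) := by field_simp; ring
          _ ≤ _ := by
            have : 0 ≤ 8 * ε * ((1 - r ^ 2) / ‖ζ - r * z‖ ^ 2) := by positivity
            linarith
    have hPc : ContinuousOn (fun ζ => (1 - r ^ 2) / ‖ζ - r * z‖ ^ 2) (sphere 0 1) :=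
      ContinuousOn.div (by fun_prop) (by fun_prop) fun ζ hζ => by simpa using hsph ζ hζ
    have hPi := integrable_circleSigma_of_continuousOn hPc
    have hP := circleAverage_poissonKernel (hball r h0 h1)
    rw [norm_mul, hz, Complex.norm_real, Real.norm_of_nonneg h0, mul_one,
      ← integral_circleSigma] at hP
    rw [hrep r h0 h1, ← integral_circleSigma]
    refine (norm_integral_le_integral_norm _).trans ?_
    refine (integral_mono_of_nonneg (Eventually.of_forall fun _ => norm_nonneg _)
      ((hPi.const_mul (8 * ε)).add (integrable_const (32 * M / δ ^ 2 * (1 - r ^ 2))))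
      (ae_circleSigma_norm_eq_one.mono fun ζ hζ => hpw ζ (by simpa using hζ))).trans ?_
    rw [integral_add' (hPi.const_mul _) (integrable_const _), integral_const_mul, hP]
    simp
  rw [Metric.tendsto_nhds]
  intro ε hε
  obtain ⟨A, hA⟩ := hbound (ε / 16) (by positivity)
  have hlim : Tendsto (fun r : ℝ => 8 * (ε / 16) + A * (1 - r ^ 2)) (𝓝[<] 1)
      (𝓝 (8 * (ε / 16) + A * (1 - 1 ^ 2))) :=
    (Continuous.tendsto (by fun_prop) 1).mono_left nhdsWithin_le_nhds
  have hlt : 8 * (ε / 16) + A * (1 - 1 ^ 2) < ε := by linarith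
  filter_upwards [hlim.eventually (gt_mem_nhds hlt),
    Ioo_mem_nhdsLT (zero_lt_one' ℝ)] with r hr hr01
  rw [dist_eq_norm]
  exact (hA r hr01.1.le hr01.2).trans_lt hr

/-- If `θ ↦ Φ (circleMap 0 1 θ)` is differentiable at `θ`, then `Φ` has a derivative along the
circle. -/
theorem exists_deriv_along_circle {Φ : ℂ → ℂ} {θ : ℝ}
    (h : DifferentiableAt ℝ (fun x => Φ (circleMap 0 1 x)) θ) :
    ∃ L : ℂ, ∀ ε > 0, ∀ᶠ ζ in 𝓝[sphere 0 1] (circleMap 0 1 θ),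
      ‖Φ ζ - Φ (circleMap 0 1 θ) - L * (ζ - circleMap 0 1 θ)‖ ≤ ε * ‖ζ - circleMap 0 1 θ‖ := by
  set z := circleMap 0 1 θ with hz
  have hz1 : ‖z‖ = 1 := by simp [hz]
  have hz0 : z ≠ 0 := norm_ne_zero_iff.1 (by simp [hz1])
  set D := deriv (fun x => Φ (circleMap 0 1 x)) θ with hD
  -- The parametrization has velocity `iz` at `z`, so this `L` matches the derivative in the angle.
  set L := D / (z * Complex.I) with hL
  have hLD : L * (z * Complex.I) = D := div_mul_cancel₀ _ (mul_ne_zero hz0 Complex.I_ne_zero)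
  refine ⟨L, fun ε hε => ?_⟩
  have hG : HasDerivAt (fun x => Φ (circleMap 0 1 x) - L * circleMap 0 1 x) 0 θ := by
    have := h.hasDerivAt.sub ((hasDerivAt_circleMap 0 1 θ).const_mul L)
    rwa [← hz, hLD, sub_self] at this
  -- Dividing by `π/2` compensates for the ratio of arc to chord, which is at most `π/2`.
  have ho := (hasDerivAt_iff_isLittleO.1 hG).def (c := ε / (Real.pi / 2)) (by positivity)
  have harg : Tendsto (fun ζ : ℂ => θ + (ζ / z).arg) (𝓝[sphere 0 1] z) (𝓝 θ) := by
    have hc : ContinuousAt (fun ζ : ℂ => θ + (ζ / z).arg) z := by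
      refine continuousAt_const.add (ContinuousAt.comp (g := Complex.arg) ?_ (by fun_prop))
      rw [div_self hz0]
      exact Complex.continuousAt_arg Complex.one_mem_slitPlane
    have := hc.tendsto
    rw [div_self hz0, Complex.arg_one, add_zero] at this
    exact this.mono_left nhdsWithin_le_nhds
  filter_upwards [harg.eventually ho, self_mem_nhdsWithin] with ζ hζ hs
  have hζ1 : ‖ζ‖ = 1 := by simpa using hs
  have hcm : circleMap 0 1 (θ + (ζ / z).arg) = ζ := by
    have h1 : ((ζ / z).arg * Complex.I).exp = ζ / z := by
      have := Complex.norm_mul_exp_arg_mul_I (ζ / z)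
      rwa [norm_div, hζ1, hz1, div_one, Complex.ofReal_one, one_mul] at this
    have h2 : z = (θ * Complex.I).exp := by simp [hz, circleMap]
    simp only [circleMap, Complex.ofReal_one, one_mul, zero_add, Complex.ofReal_add, add_mul,
      Complex.exp_add, h1, ← h2]
    field_simp
  have hang : |(ζ / z).arg| ≤ Real.pi / 2 * ‖ζ - z‖ := by
    rw [← Complex.angle_eq_abs_arg (norm_ne_zero_iff.1 (by simp [hζ1])) hz0]
    exact Complex.angle_le_mul_norm_sub hζ1 hz1
  rw [hcm, ← hz, smul_zero, sub_zero, add_sub_cancel_left, Real.norm_eq_abs] at hζ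
  calc ‖Φ ζ - Φ z - L * (ζ - z)‖ = ‖Φ ζ - L * ζ - (Φ z - L * z)‖ := by congr 1; ring
    _ ≤ ε / (Real.pi / 2) * |(ζ / z).arg| := hζ
    _ ≤ ε / (Real.pi / 2) * (Real.pi / 2 * ‖ζ - z‖) := by gcongr
    _ = ε * ‖ζ - z‖ := by field_simp

/-- **Fatou's theorem** for bounded analytic functions on the disc. -/
theorem exists_isBoundaryFunction {φ : ℂ → ℂ} (hφ : DifferentiableOn ℂ φ (ball 0 1))
    (hmaps : MapsTo φ (ball 0 1) (ball 0 1)) : ∃ φb : ℂ → ℂ, IsBoundaryFunction φ φb := by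
  -- A primitive of `φ` is 1-Lipschitz on the disc. A Lipschitz extension to the plane gives it
  -- values on the circle, where Rademacher's theorem applies.
  obtain ⟨Φ₀, hΦ₀⟩ := hφ.isExactOn_ball
  have hlip : LipschitzOnWith 1 Φ₀ (ball 0 1) := by
    refine (convex_ball (0 : ℂ) 1).lipschitzOnWith_of_nnnorm_hasDerivWithin_le
      (f' := φ) (fun z hz => (hΦ₀ z hz).hasDerivWithinAt) fun z hz => ?_
    have := hmaps hz
    rw [mem_ball_zero_iff] at this
    exact_mod_cast this.le
  obtain ⟨Φ, hΦ, heq⟩ := hlip.extend_finite_dimension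
  have hd : ∀ z ∈ ball (0 : ℂ) 1, HasDerivAt Φ (φ z) z := fun z hz =>
    (hΦ₀ z hz).congr_of_eventuallyEq (by
      filter_upwards [isOpen_ball.mem_nhds hz] with u hu using (heq hu).symm)
  have hae : ∀ᵐ z ∂circleSigma, ∃ L : ℂ, Tendsto (fun t : ℝ => φ (t * z)) (𝓝[<] 1) (𝓝 L) := by
    apply ae_circleSigma_of_ae_angle
    have hl := hΦ.comp (lipschitzWith_circleMap 0 1)
    filter_upwards [hl.ae_differentiableAt] with θ hθ
    obtain ⟨L, hL⟩ := exists_deriv_along_circle hθ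
    refine ⟨L, (tendsto_deriv_radial hΦ (fun z hz =>
      (hd z hz).differentiableAt.differentiableWithinAt) (by simp) hL).congr' ?_⟩
    filter_upwards [Ioo_mem_nhdsLT (zero_lt_one' ℝ)] with t ht
    refine (hd _ ?_).deriv
    simpa [abs_of_pos ht.1] using ht.2
  refine ⟨fun z => limUnder (𝓝[<] 1) (fun t : ℝ => φ (t * z)), ?_⟩
  filter_upwards [hae] with z hz using tendsto_nhds_limUnder hz

/-! ### The lower bound by interpolation -/

/-- Evaluation at a point of the disc, as a linear functional on `H²`. -/
noncomputable def HardyTwo.evalLinear {z : ℂ} (hz : ‖z‖ < 1) : HardyTwo →ₗ[ℂ] ℂ where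
  toFun f := f.eval z
  map_add' f g := f.eval_add g hz
  map_smul' c f := f.eval_smul c z

theorem HardyTwo.ext_of_norm_lt_one (f : HardyTwo) {z : ℂ} (hz : ‖z‖ < 1) :
    f.ext z = f.eval z := by
  simp [HardyTwo.ext, hz]

theorem HardyTwo.ext_zero (z : ℂ) : (0 : HardyTwo).ext z = 0 := by
  have h : ∀ w, (0 : HardyTwo).eval w = 0 := fun w => by simp [HardyTwo.eval]
  unfold HardyTwo.ext
  simp only [h]
  split_ifs
  · rfl
  · exact tendsto_const_nhds.limUnder_eq

/-- The Carleson norm is itself an admissible constant in the Carleson inequality. -/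
theorem lintegral_ext_sq_le (μ : Measure ℂ) (f : HardyTwo) :
    ∫⁻ z in closedBall (0 : ℂ) 1, ‖f.ext z‖ₑ ^ 2 ∂μ ≤ carlesonNorm μ * ‖f‖ₑ ^ 2 := by
  by_cases hf : f = 0
  · simp [hf, HardyTwo.ext_zero]
  · have h0 : ‖f‖ₑ ^ 2 ≠ 0 := by simpa using hf
    rw [← ENNReal.div_le_iff h0 (by simp)]
    exact le_sInf fun K hK => (ENNReal.div_le_iff h0 (by simp)).2 (hK f)

theorem sum_le_carlesonNorm_sequenceMeasure {n : ℕ} {Z : Fin n → ℂ} (hZ : ∀ j, ‖Z j‖ < 1)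
    (f : HardyTwo) : ∑ j, ENNReal.ofReal (1 - ‖Z j‖ ^ 2) * ‖f.eval (Z j)‖ₑ ^ 2
      ≤ carlesonNorm (sequenceMeasure Z) * ‖f‖ₑ ^ 2 := by
  refine le_trans (le_of_eq ?_) (lintegral_ext_sq_le _ f)
  rw [sequenceMeasure, Measure.restrict_sum _ measurableSet_closedBall, lintegral_sum_measure,
    tsum_fintype]
  refine Finset.sum_congr rfl fun j _ => ?_
  classical
  rw [Measure.restrict_smul, lintegral_smul_measure, restrict_dirac' measurableSet_closedBall,
    if_pos (by simpa using (hZ j).le), lintegral_dirac, f.ext_of_norm_lt_one (hZ j), smul_eq_mul]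

/-- Fewer than `n` dimensions do not suffice to fill the values at `n` points. -/
theorem exists_annihilator_of_rank_lt {n : ℕ} {R : HardyTwo →L[ℂ] HardyTwo}
    (hR : LinearMap.rank (R : HardyTwo →ₗ[ℂ] HardyTwo) < (n : Cardinal)) {Z : Fin n → ℂ}
    (hZ : ∀ j, ‖Z j‖ < 1) :
    ∃ α : Fin n → ℂ, α ≠ 0 ∧ ∀ f, ∑ j, α j * (R f).eval (Z j) = 0 := by
  set T : HardyTwo →ₗ[ℂ] (Fin n → ℂ) :=
    (LinearMap.pi fun j => HardyTwo.evalLinear (hZ j)) ∘ₗ (R : HardyTwo →ₗ[ℂ] HardyTwo) with hT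
  have hlt : LinearMap.range T < ⊤ := by
    refine lt_top_iff_ne_top.2 fun htop => ?_
    have h1 : LinearMap.rank T < (n : Cardinal) := (LinearMap.rank_comp_le_right _ _).trans_lt hR
    rw [LinearMap.rank, htop, rank_top, rank_fin_fun] at h1
    exact h1.false
  obtain ⟨g, hg, hle⟩ := Submodule.exists_le_ker_of_lt_top _ hlt
  refine ⟨fun j => g (Pi.single j 1), fun h => hg ?_, fun f => ?_⟩
  · ext j
    exact congrFun h j
  · have h1 : g (T f) = 0 := hle (LinearMap.mem_range_self T f)
    have h2 := LinearMap.pi_apply_eq_sum_univ g (T f)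
    rw [h1] at h2
    rw [h2]
    refine Finset.sum_congr rfl fun j _ => ?_
    have h3 : (Pi.single j 1 : Fin n → ℂ) = fun i => if j = i then 1 else 0 := by
      funext i
      simp [Pi.single_apply, eq_comm]
    beta_reduce
    rw [smul_eq_mul, mul_comm, h3]
    rfl

/-- Duality: the relation `α` that annihilates the values of `R` tests `C - R` on one well-chosen
interpolating function. -/
theorem exists_ratio_le_of_rank_lt {φ : ℂ → ℂ} (hmaps : MapsTo φ (ball 0 1) (ball 0 1))
    {C : HardyTwo →L[ℂ] HardyTwo} (hC : IsCompositionOperator φ C) {n : ℕ} (hn : 1 ≤ n)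
    {R : HardyTwo →L[ℂ] HardyTwo}
    (hR : LinearMap.rank (R : HardyTwo →ₗ[ℂ] HardyTwo) < (n : Cardinal))
    {Z : Fin n → ℂ} (hZ : ∀ j, Z j ∈ ball (0 : ℂ) 1) {c K : ℝ}
    (hI : ∀ a : Fin n → ℂ, ∃ f : HardyTwo, (∀ j, f.eval (φ (Z j)) = a j) ∧
      ‖f‖ ≤ c * √(∑ j, ‖a j‖ ^ 2 * (1 - ‖φ (Z j)‖ ^ 2)))
    (hK : ∀ h : HardyTwo, ∑ j, (1 - ‖Z j‖ ^ 2) * ‖h.eval (Z j)‖ ^ 2 ≤ K * ‖h‖ ^ 2) :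
    ∃ j, (1 - ‖Z j‖ ^ 2) / (1 - ‖φ (Z j)‖ ^ 2) ≤ K * (‖C - R‖ * c) ^ 2 := by
  have hZ1 : ∀ j, ‖Z j‖ < 1 := fun j => by simpa using hZ j
  have hw1 : ∀ j, ‖φ (Z j)‖ < 1 := fun j => by simpa using hmaps (hZ j)
  have hzp : ∀ j, 0 < 1 - ‖Z j‖ ^ 2 := fun j => by
    have := pow_lt_one₀ (norm_nonneg _) (hZ1 j) two_ne_zero; linarith
  have hwp : ∀ j, 0 < 1 - ‖φ (Z j)‖ ^ 2 := fun j => by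
    have := pow_lt_one₀ (norm_nonneg _) (hw1 j) two_ne_zero; linarith
  have : Nonempty (Fin n) := ⟨⟨0, hn⟩⟩
  obtain ⟨i, hi⟩ := Finite.exists_min (fun j => (1 - ‖Z j‖ ^ 2) / (1 - ‖φ (Z j)‖ ^ 2))
  refine ⟨i, ?_⟩
  set q := (1 - ‖Z i‖ ^ 2) / (1 - ‖φ (Z i)‖ ^ 2) with hq
  have hq0 : 0 < q := div_pos (hzp i) (hwp i)
  obtain ⟨α, hα, hann⟩ := exists_annihilator_of_rank_lt hR hZ1
  set A := ∑ j, ‖α j‖ ^ 2 / (1 - ‖φ (Z j)‖ ^ 2) with hA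
  have hApos : 0 < A := by
    obtain ⟨j, hj⟩ := Function.ne_iff.1 hα
    refine Finset.sum_pos' (fun j _ => div_nonneg (sq_nonneg _) (hwp j).le)
      ⟨j, Finset.mem_univ _, div_pos (pow_pos (norm_pos_iff.2 hj) 2) (hwp j)⟩
  -- These data make both the pairing `∑ αⱼ f(φ(zⱼ))` and the weighted square sum in the
  -- interpolation bound equal to `A`.
  obtain ⟨f, hf, hfn⟩ := hI fun j => (starRingEnd ℂ) (α j) / ((1 - ‖φ (Z j)‖ ^ 2 : ℝ) : ℂ)
  have hsumA : ∑ j, ‖(starRingEnd ℂ) (α j) / ((1 - ‖φ (Z j)‖ ^ 2 : ℝ) : ℂ)‖ ^ 2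
      * (1 - ‖φ (Z j)‖ ^ 2) = A := by
    refine Finset.sum_congr rfl fun j _ => ?_
    rw [norm_div, RCLike.norm_conj, Complex.norm_real, Real.norm_of_nonneg (hwp j).le]
    field_simp [(hwp j).ne']
  rw [hsumA] at hfn
  set h := (C - R) f with hh
  have hval : ∑ j, α j * h.eval (Z j) = (A : ℂ) := by
    have e : ∀ j, α j * h.eval (Z j) = (‖α j‖ ^ 2 / (1 - ‖φ (Z j)‖ ^ 2) : ℝ)
        - α j * (R f).eval (Z j) := by
      intro j
      have : h.eval (Z j) = (C f).eval (Z j) - (R f).eval (Z j) :=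
        HardyTwo.eval_sub (C f) (R f) (hZ1 j)
      rw [this, hC f _ (hZ j), hf, mul_sub, ← mul_div_assoc, Complex.mul_conj']
      push_cast
      rfl
    rw [Finset.sum_congr rfl fun j _ => e j, Finset.sum_sub_distrib, hann f, sub_zero, hA]
    push_cast
    rfl
  -- The weights `√(1 - ‖Z j‖²)` are split so that Cauchy–Schwarz leaves the Carleson sum of `h` in
  -- one factor and, by minimality of `q`, at most `A / q` in the other.
  have hle : A ≤ ∑ j, ‖α j‖ / √(1 - ‖Z j‖ ^ 2) * (√(1 - ‖Z j‖ ^ 2) * ‖h.eval (Z j)‖) := by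
    calc A = ‖(A : ℂ)‖ := by simp [abs_of_pos hApos]
      _ ≤ ∑ j, ‖α j * h.eval (Z j)‖ := hval ▸ norm_sum_le _ _
      _ = _ := by
        refine Finset.sum_congr rfl fun j _ => ?_
        have := (Real.sqrt_pos.2 (hzp j)).ne'
        rw [norm_mul]
        field_simp
  have hCS := Finset.sum_mul_sq_le_sq_mul_sq Finset.univ
    (fun j => ‖α j‖ / √(1 - ‖Z j‖ ^ 2)) (fun j => √(1 - ‖Z j‖ ^ 2) * ‖h.eval (Z j)‖)
  have h1 : ∑ j, (‖α j‖ / √(1 - ‖Z j‖ ^ 2)) ^ 2 ≤ A / q := by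
    rw [hA, Finset.sum_div]
    refine Finset.sum_le_sum fun j _ => ?_
    rw [div_pow, Real.sq_sqrt (hzp j).le, div_div]
    have := (le_div_iff₀ (hwp j)).1 (hi j)
    have := mul_pos hq0 (hwp j)
    rw [mul_comm (1 - ‖φ (Z j)‖ ^ 2) q]
    gcongr
  have h2 : ∑ j, (√(1 - ‖Z j‖ ^ 2) * ‖h.eval (Z j)‖) ^ 2 ≤ K * ‖h‖ ^ 2 := by
    refine le_trans (le_of_eq ?_) (hK h)
    refine Finset.sum_congr rfl fun j _ => ?_
    rw [mul_pow, Real.sq_sqrt (hzp j).le]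
  have hK0 : 0 ≤ K * ‖h‖ ^ 2 := (Finset.sum_nonneg fun j _ => sq_nonneg _).trans h2
  have h3 : A ^ 2 ≤ A / q * (K * ‖h‖ ^ 2) :=
    (pow_le_pow_left₀ hApos.le hle 2).trans (hCS.trans (mul_le_mul h1 h2
      (Finset.sum_nonneg fun j _ => sq_nonneg _) (div_pos hApos hq0).le))
  have hhn : ‖h‖ ^ 2 ≤ (‖C - R‖ * c) ^ 2 * A := by
    have : ‖h‖ ≤ ‖C - R‖ * (c * √A) :=
      ((C - R).le_opNorm f).trans (by gcongr)
    calc ‖h‖ ^ 2 ≤ (‖C - R‖ * (c * √A)) ^ 2 := by gcongr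
      _ = (‖C - R‖ * c) ^ 2 * √A ^ 2 := by ring
      _ = _ := by rw [Real.sq_sqrt hApos.le]
  -- As `A > 0`, `h` cannot vanish; the Carleson inequality for `h` then forces `K ≥ 0`.
  have hh0 : 0 < ‖h‖ ^ 2 := by
    have : h ≠ 0 := by
      intro h0
      have : A ≤ 0 := hle.trans (le_of_eq (Finset.sum_eq_zero fun j _ => by
        simp [h0, HardyTwo.eval]))
      linarith
    positivity
  have hKn : 0 ≤ K := nonneg_of_mul_nonneg_left hK0 hh0
  have h4 : q * A ^ 2 ≤ (K * (‖C - R‖ * c) ^ 2) * A ^ 2 := by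
    have h5 : q * A ^ 2 ≤ q * (A / q * (K * ‖h‖ ^ 2)) := by gcongr
    have h6 : q * (A / q * (K * ‖h‖ ^ 2)) = A * K * ‖h‖ ^ 2 := by field_simp
    have h7 : A * K * ‖h‖ ^ 2 ≤ A * K * ((‖C - R‖ * c) ^ 2 * A) := by gcongr
    calc q * A ^ 2 ≤ _ := h5.trans (h6.le.trans h7)
      _ = _ := by ring
  exact le_of_mul_le_mul_right h4 (by positivity)

/-- The lower bound for approximation numbers by interpolation. -/
theorem le_approxNumber {φ : ℂ → ℂ} (hmaps : MapsTo φ (ball 0 1) (ball 0 1))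
    {C : HardyTwo →L[ℂ] HardyTwo} (hC : IsCompositionOperator φ C) {n : ℕ} (hn : 1 ≤ n)
    {Z : Fin n → ℂ} (hZ : ∀ j, Z j ∈ ball (0 : ℂ) 1) :
    (interpolationConst fun j => φ (Z j))⁻¹ * carlesonNorm (sequenceMeasure Z) ^ (-(1 / 2) : ℝ)
      * ⨅ j, ENNReal.ofReal ((1 - ‖Z j‖ ^ 2) / (1 - ‖φ (Z j)‖ ^ 2)) ^ (1 / 2 : ℝ)
      ≤ approxNumber n C := by
  have hZ1 : ∀ j, ‖Z j‖ < 1 := fun j => by simpa using hZ j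
  have hzp : ∀ j, 0 ≤ 1 - ‖Z j‖ ^ 2 := fun j => by
    have := pow_le_one₀ (n := 2) (norm_nonneg _) (hZ1 j).le; linarith
  have hwp : ∀ j, 0 ≤ 1 - ‖φ (Z j)‖ ^ 2 := fun j => by
    have h1 : ‖φ (Z j)‖ < 1 := by simpa using hmaps (hZ j)
    have := pow_le_one₀ (n := 2) (norm_nonneg _) h1.le; linarith
  refine le_infEDist.2 fun R hR => ?_
  rw [edist_eq_enorm_sub]
  set q := ⨅ j, ENNReal.ofReal ((1 - ‖Z j‖ ^ 2) / (1 - ‖φ (Z j)‖ ^ 2)) ^ (1 / 2 : ℝ) with hq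
  set K := carlesonNorm (sequenceMeasure Z) with hKdef
  -- If `K` or the constant of interpolation is infinite, its negative power is `0` and so is the
  -- left side.
  by_cases hK : K = ∞
  · simp [hK]
  by_cases hM : (interpolationConst fun j => φ (Z j)) = ∞
  · simp [hM]
  set x := ‖C - R‖ₑ with hx
  have key : ∀ c : ℝ≥0∞, c ≠ ∞ → (∀ a : Fin n → ℂ,
      (∑' j, ‖a j‖ₑ ^ 2 * ENNReal.ofReal (1 - ‖φ (Z j)‖ ^ 2)) < ∞ →
      ∃ f : HardyTwo, (∀ j, f.eval (φ (Z j)) = a j) ∧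
      ‖f‖ₑ ≤ c * (∑' j, ‖a j‖ₑ ^ 2 * ENNReal.ofReal (1 - ‖φ (Z j)‖ ^ 2)) ^ (1 / 2 : ℝ)) →
      q ≤ c * (K ^ (1 / 2 : ℝ) * x) := by
    intro c hc hint
    have hofe : ∀ a : Fin n → ℂ, ∑' j, ‖a j‖ₑ ^ 2 * ENNReal.ofReal (1 - ‖φ (Z j)‖ ^ 2)
        = ENNReal.ofReal (∑ j, ‖a j‖ ^ 2 * (1 - ‖φ (Z j)‖ ^ 2)) := by
      intro a
      rw [tsum_fintype, ENNReal.ofReal_sum_of_nonneg fun j _ => mul_nonneg (sq_nonneg _) (hwp j)]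
      refine Finset.sum_congr rfl fun j _ => ?_
      rw [ENNReal.ofReal_mul (sq_nonneg _), ENNReal.ofReal_pow (norm_nonneg _), ofReal_norm]
    obtain ⟨j, hj⟩ := exists_ratio_le_of_rank_lt hmaps hC hn hR hZ (c := c.toReal) (K := K.toReal)
      (fun a => by
        obtain ⟨f, hf, hfn⟩ := hint a (by rw [hofe]; exact ENNReal.ofReal_lt_top)
        refine ⟨f, hf, ?_⟩
        rw [hofe, ← ENNReal.ofReal_toReal hc, ENNReal.ofReal_rpow_of_nonneg
          (Finset.sum_nonneg fun j _ => mul_nonneg (sq_nonneg _) (hwp j)) (by norm_num),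
          ← Real.sqrt_eq_rpow, ← ENNReal.ofReal_mul ENNReal.toReal_nonneg, ← ofReal_norm] at hfn
        exact (ENNReal.ofReal_le_ofReal_iff (by positivity)).1 hfn) (fun h => by
        have h1 := sum_le_carlesonNorm_sequenceMeasure hZ1 h
        rw [← hKdef, ← ENNReal.ofReal_toReal hK, ← ofReal_norm, ← ENNReal.ofReal_pow (norm_nonneg _),
          ← ENNReal.ofReal_mul ENNReal.toReal_nonneg] at h1
        refine (ENNReal.ofReal_le_ofReal_iff (by positivity)).1 (le_trans (le_of_eq ?_) h1)
        rw [ENNReal.ofReal_sum_of_nonneg fun j _ => mul_nonneg (hzp j) (sq_nonneg _)]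
        refine Finset.sum_congr rfl fun j _ => ?_
        rw [ENNReal.ofReal_mul (hzp j), ENNReal.ofReal_pow (norm_nonneg _), ofReal_norm])
    refine (iInf_le _ j).trans ?_
    have h0 := div_nonneg (hzp j) (hwp j)
    rw [ENNReal.ofReal_rpow_of_nonneg h0 (by norm_num), ← Real.sqrt_eq_rpow]
    refine (ENNReal.ofReal_le_ofReal (Real.sqrt_le_sqrt hj)).trans (le_of_eq ?_)
    rw [Real.sqrt_mul ENNReal.toReal_nonneg, Real.sqrt_sq (by positivity),
      ENNReal.ofReal_mul (by positivity), ENNReal.ofReal_mul (by positivity), ofReal_norm,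
      ENNReal.ofReal_toReal hc, Real.sqrt_eq_rpow,
      ← ENNReal.ofReal_rpow_of_nonneg ENNReal.toReal_nonneg (by norm_num), ENNReal.ofReal_toReal hK]
    ring
  set M := interpolationConst fun j => φ (Z j) with hMdef
  -- Dividing by `K ^ (1/2) * x` passes to the infimum over admissible `c`, attained or not. When
  -- this factor is `0`, one finite admissible `c` already gives `q = 0`.
  have hqM : q ≤ M * (K ^ (1 / 2 : ℝ) * x) := by
    have hb : K ^ (1 / 2 : ℝ) * x ≠ ∞ :=
      ENNReal.mul_ne_top (ENNReal.rpow_ne_top_of_nonneg (by norm_num) hK) (by simp [hx])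
    by_cases hb0 : K ^ (1 / 2 : ℝ) * x = 0
    · obtain ⟨c, hc, hclt⟩ := sInf_lt_iff.1 (lt_top_iff_ne_top.2 hM)
      have := key c hclt.ne hc
      rw [hb0, mul_zero] at this ⊢
      exact this
    · rw [← ENNReal.div_le_iff hb0 hb]
      refine le_sInf fun c hc => ?_
      by_cases hct : c = ∞
      · simp [hct]
      · exact (ENNReal.div_le_iff hb0 hb).2 (key c hct hc)
  calc M⁻¹ * K ^ (-(1 / 2) : ℝ) * q
      ≤ M⁻¹ * (K ^ (1 / 2 : ℝ))⁻¹ * (M * (K ^ (1 / 2 : ℝ) * x)) := by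
        rw [ENNReal.rpow_neg]; gcongr
    _ = (M⁻¹ * M) * ((K ^ (1 / 2 : ℝ))⁻¹ * K ^ (1 / 2 : ℝ)) * x := by ring
    _ ≤ 1 * 1 * x := by gcongr <;> exact ENNReal.inv_mul_le_one _
    _ = x := by simp

/-! ### Polynomials in `H²` and boundary values of compositions -/

open Polynomial

namespace HardyTwo

/-- Polynomials as elements of `H²`. -/
noncomputable def ofPolynomial : ℂ[X] →ₗ[ℂ] HardyTwo where
  toFun p := mk p.coeff (summable_of_hasFiniteSupport
    (p.support.finite_toSet.subset fun k hk => by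
      rw [Finset.mem_coe, Polynomial.mem_support_iff]
      rintro h
      simp [h] at hk))
  map_add' p q := by ext k; simp
  map_smul' c p := by ext k; simp

@[simp] theorem ofPolynomial_apply (p : ℂ[X]) (k : ℕ) : ofPolynomial p k = p.coeff k := rfl

theorem eval_ofPolynomial (p : ℂ[X]) (z : ℂ) : (ofPolynomial p).eval z = p.eval z := by
  rw [HardyTwo.eval, Polynomial.eval_eq_sum, Polynomial.sum]
  exact tsum_eq_sum fun k hk => by simp [Polynomial.notMem_support_iff.1 hk]

theorem tendsto_radial_eval (p : ℂ[X]) (z : ℂ) :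
    Tendsto (fun t : ℝ => p.eval ((t : ℂ) * z)) (𝓝[<] 1) (𝓝 (p.eval z)) := by
  have h : Continuous fun t : ℝ => p.eval ((t : ℂ) * z) := by fun_prop
  simpa using (h.tendsto 1).mono_left nhdsWithin_le_nhds

/-- Polynomials have radial limits at every point, so the Carleson inequality can be applied to them
even when the pullback measure charges null sets of the circle. -/
theorem ext_ofPolynomial (p : ℂ[X]) (z : ℂ) : (ofPolynomial p).ext z = p.eval z := by
  unfold HardyTwo.ext
  simp only [eval_ofPolynomial]
  split_ifs
  · rfl
  · exact (tendsto_radial_eval p z).limUnder_eq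

theorem mem_closure_range_ofPolynomial (f : HardyTwo) : f ∈ closure (range ofPolynomial) := by
  have h := lp.hasSum_single (p := 2) (by norm_num) f
  refine mem_closure_of_tendsto h.tendsto_sum_nat (Eventually.of_forall fun N => ?_)
  refine ⟨∑ k ∈ Finset.range N, monomial k (f k), ?_⟩
  rw [map_sum]
  refine Finset.sum_congr rfl fun k _ => ?_
  ext i
  simp [Polynomial.coeff_monomial, lp.single_apply, Pi.single_apply, eq_comm]

/-- The norm of a bounded analytic function in `H²` is the `L²` norm of its radial limits. -/
theorem enorm_sq_eq_lintegral (F : HardyTwo) {G : ℂ → ℂ} {M : ℝ}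
    (hM : ∀ z ∈ ball (0 : ℂ) 1, ‖F.eval z‖ ≤ M)
    (hG : ∀ᵐ z ∂circleSigma,
      Tendsto (fun t : ℝ => F.eval ((t : ℂ) * z)) (𝓝[<] 1) (𝓝 (G z))) :
    ‖F‖ₑ ^ 2 = ∫⁻ z, ‖G z‖ₑ ^ 2 ∂circleSigma := by
  set t : ℕ → ℝ := fun n => 1 - 1 / ((n : ℝ) + 1) with ht
  have ht0 : ∀ n, 0 ≤ t n := fun n => by
    have : 1 / ((n : ℝ) + 1) ≤ 1 := by
      rw [div_le_one (by positivity)]; linarith [n.cast_nonneg (α := ℝ)]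
    simp only [ht]; linarith
  have ht1 : ∀ n, t n < 1 := fun n => by
    have : 0 < 1 / ((n : ℝ) + 1) := by positivity
    simp only [ht]; linarith
  have htt : Tendsto t atTop (𝓝 1) := by
    simpa [ht] using (tendsto_const_nhds (x := (1 : ℝ))).sub
      (tendsto_one_div_add_atTop_nhds_zero_nat (𝕜 := ℝ))
  have htl : Tendsto t atTop (𝓝[<] 1) :=
    tendsto_nhdsWithin_iff.2 ⟨htt, Eventually.of_forall ht1⟩
  have hmem : ∀ n, ∀ z : ℂ, ‖z‖ = 1 → (t n : ℂ) * z ∈ ball (0 : ℂ) 1 := fun n z hz => by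
    simpa [hz, abs_of_nonneg (ht0 n)] using ht1 n
  have hmeas : ∀ n, AEStronglyMeasurable (fun z : ℂ => F.eval (t n * z)) circleSigma := fun n =>
    (integrable_circleSigma_of_continuousOn (F.differentiableOn_eval.continuousOn.comp
      (by fun_prop) fun z hz => hmem n z (by simpa using hz))).aestronglyMeasurable
  have hGn : ∀ᵐ z ∂circleSigma, Tendsto (fun n => F.eval (t n * z)) atTop (𝓝 (G z)) :=
    hG.mono fun z hz => hz.comp htl
  have hGm : AEStronglyMeasurable G circleSigma := aestronglyMeasurable_of_tendsto_ae atTop hmeas hGn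
  have hbd : ∀ n, ∀ᵐ z ∂circleSigma, ‖‖F.eval (t n * z)‖ ^ 2‖ ≤ M ^ 2 := fun n => by
    filter_upwards [ae_circleSigma_norm_eq_one] with z hz
    rw [Real.norm_of_nonneg (by positivity)]
    gcongr
    exact hM _ (hmem n z hz)
  have hlimR : Tendsto (fun n => ∫ z, ‖F.eval (t n * z)‖ ^ 2 ∂circleSigma) atTop
      (𝓝 (∫ z, ‖G z‖ ^ 2 ∂circleSigma)) :=
    tendsto_integral_of_dominated_convergence (fun _ => M ^ 2) (fun n => (hmeas n).norm.pow 2)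
      (integrable_const _) hbd (hGn.mono fun z hz => hz.norm.pow 2)
  have hlimL : Tendsto (fun n => ∑' k, ‖F k‖ ^ 2 * (t n ^ 2) ^ k) atTop
      (𝓝 (∑' k, ‖F k‖ ^ 2)) := by
    refine tendsto_tsum_of_dominated_convergence F.hasSum_norm_sq.summable (fun k => ?_)
      (Eventually.of_forall fun n k => ?_)
    · simpa using ((htt.pow 2).pow k).const_mul (‖F k‖ ^ 2)
    · rw [Real.norm_of_nonneg (mul_nonneg (sq_nonneg _) (pow_nonneg (sq_nonneg _) _))]
      exact mul_le_of_le_one_right (sq_nonneg _)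
        (pow_le_one₀ (sq_nonneg _) (pow_le_one₀ (ht0 n) (ht1 n).le))
  simp_rw [(F.hasSum_norm_sq_circle (ht0 _) (ht1 _)).tsum_eq, F.hasSum_norm_sq.tsum_eq] at hlimL
  have heq : ‖F‖ ^ 2 = ∫ z, ‖G z‖ ^ 2 ∂circleSigma := tendsto_nhds_unique hlimL hlimR
  have hGb : ∀ᵐ z ∂circleSigma, ‖‖G z‖ ^ 2‖ ≤ M ^ 2 := by
    filter_upwards [hGn, ae_all_iff.2 hbd] with z hz hb
    exact le_of_tendsto (hz.norm.pow 2).norm (Eventually.of_forall hb)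
  have hGi : Integrable (fun z => ‖G z‖ ^ 2) circleSigma :=
    Integrable.of_bound (hGm.norm.pow 2) (M ^ 2) hGb
  rw [← ofReal_norm, ← ENNReal.ofReal_pow (norm_nonneg _), heq,
    ofReal_integral_eq_lintegral_ofReal hGi (Eventually.of_forall fun z => sq_nonneg _)]
  refine lintegral_congr fun z => ?_
  rw [ENNReal.ofReal_pow (norm_nonneg _), ofReal_norm]

theorem exists_norm_polynomial_eval_le (p : ℂ[X]) : ∃ M : ℝ, ∀ z ∈ ball (0 : ℂ) 1, ‖p.eval z‖ ≤ M := by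
  obtain ⟨M, hM⟩ := (isCompact_closedBall (0 : ℂ) 1).exists_bound_of_continuousOn
    (f := fun z => p.eval z) (by fun_prop)
  exact ⟨M, fun z hz => hM z (ball_subset_closedBall hz)⟩

theorem enorm_sq_ofPolynomial (p : ℂ[X]) :
    ‖ofPolynomial p‖ₑ ^ 2 = ∫⁻ z, ‖p.eval z‖ₑ ^ 2 ∂circleSigma := by
  obtain ⟨M, hM⟩ := exists_norm_polynomial_eval_le p
  refine enorm_sq_eq_lintegral _ (M := M) (by simpa only [eval_ofPolynomial] using hM)
    (Eventually.of_forall fun z => ?_)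
  simpa only [eval_ofPolynomial] using tendsto_radial_eval p z

end HardyTwo

open HardyTwo

section Boundary

variable {φ φb : ℂ → ℂ}

theorem mul_mem_ball_of_norm_eq_one {t : ℝ} (h0 : 0 < t) (h1 : t < 1) {z : ℂ} (hz : ‖z‖ = 1) :
    (t : ℂ) * z ∈ ball (0 : ℂ) 1 := by
  simpa [hz, abs_of_pos h0] using h1

theorem IsBoundaryFunction.aemeasurable (hb : IsBoundaryFunction φ φb)
    (hφ : DifferentiableOn ℂ φ (ball 0 1)) : AEMeasurable φb circleSigma := by
  -- Adding 2 keeps all radii strictly between 0 and 1, so `φb` is an almost-everywhere limit of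
  -- functions continuous on the circle.
  have htl : Tendsto (fun n : ℕ => 1 - 1 / ((n : ℝ) + 2)) atTop (𝓝[<] 1) := by
    refine tendsto_nhdsWithin_iff.2 ⟨?_, Eventually.of_forall fun n => ?_⟩
    · have := (tendsto_one_div_add_atTop_nhds_zero_nat (𝕜 := ℝ)).comp (tendsto_add_atTop_nat 1)
      have h2 := tendsto_const_nhds (x := (1 : ℝ)).sub this
      rw [sub_zero] at h2
      refine h2.congr fun n => ?_
      simp only [Function.comp_apply]
      push_cast
      ring
    · have : 0 < 1 / ((n : ℝ) + 2) := by positivity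
      simp only [mem_Iio]
      linarith
  refine aemeasurable_of_tendsto_metrizable_ae atTop
    (f := fun (n : ℕ) z => φ (((1 - 1 / ((n : ℝ) + 2) : ℝ) : ℂ) * z)) (fun n => ?_)
    (hb.mono fun z hz => hz.comp htl)
  have h0 : 0 < 1 - 1 / ((n : ℝ) + 2) := by
    rw [sub_pos, div_lt_one (by positivity)]; linarith [n.cast_nonneg (α := ℝ)]
  have h1 : 1 - 1 / ((n : ℝ) + 2) < 1 := by
    have : 0 < 1 / ((n : ℝ) + 2) := by positivity
    linarith
  exact (integrable_circleSigma_of_continuousOn (hφ.continuousOn.comp (by fun_prop) fun z hz =>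
    mul_mem_ball_of_norm_eq_one h0 h1 (by simpa using hz))).aestronglyMeasurable.aemeasurable

theorem IsBoundaryFunction.ae_norm_le_one (hb : IsBoundaryFunction φ φb)
    (hmaps : MapsTo φ (ball 0 1) (ball 0 1)) : ∀ᵐ z ∂circleSigma, ‖φb z‖ ≤ 1 := by
  filter_upwards [hb, ae_circleSigma_norm_eq_one] with z hz hz1
  refine le_of_tendsto hz.norm ?_
  filter_upwards [Ioo_mem_nhdsLT (zero_lt_one' ℝ)] with t ht
  have := hmaps (mul_mem_ball_of_norm_eq_one ht.1 ht.2 hz1)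
  rw [mem_ball_zero_iff] at this
  exact this.le

/-- By continuity of `p`, the radial limits of `p ∘ φ` are `p ∘ φb`; the rest is a change of
variables. -/
theorem enorm_sq_comp_ofPolynomial (hb : IsBoundaryFunction φ φb)
    (hφ : DifferentiableOn ℂ φ (ball 0 1)) (hmaps : MapsTo φ (ball 0 1) (ball 0 1))
    {C : HardyTwo →L[ℂ] HardyTwo} (hC : IsCompositionOperator φ C) (p : ℂ[X]) :
    ‖C (ofPolynomial p)‖ₑ ^ 2 = ∫⁻ w, ‖p.eval w‖ₑ ^ 2 ∂(circleSigma.map φb) := by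
  obtain ⟨M, hM⟩ := exists_norm_polynomial_eval_le p
  have hev : ∀ z ∈ ball (0 : ℂ) 1, (C (ofPolynomial p)).eval z = p.eval (φ z) := fun z hz => by
    rw [hC _ z hz, eval_ofPolynomial]
  rw [lintegral_map' (by fun_prop) (hb.aemeasurable hφ)]
  refine enorm_sq_eq_lintegral _ (M := M) (fun z hz => hev z hz ▸ hM _ (hmaps hz)) ?_
  filter_upwards [hb, ae_circleSigma_norm_eq_one] with z hz hz1
  have hp : Continuous fun w => p.eval w := by fun_prop
  refine ((hp.tendsto _).comp hz).congr' ?_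
  filter_upwards [Ioo_mem_nhdsLT (zero_lt_one' ℝ)] with t ht
  exact (hev _ (mul_mem_ball_of_norm_eq_one ht.1 ht.2 hz1)).symm

end Boundary

/-! ### The upper bound by Blaschke products -/

/-- A Blaschke product of degree `d` is, up to sign, the quotient of a monic polynomial of degree
`d` by a polynomial of the same modulus on the unit circle. -/
theorem IsBlaschkeProduct.exists_polynomials {d : ℕ} {B : ℂ → ℂ} (hB : IsBlaschkeProduct d B) :
    ∃ P Q : ℂ[X], P.Monic ∧ P.natDegree = d ∧ (∀ z, ‖z‖ = 1 → ‖P.eval z‖ = ‖Q.eval z‖) ∧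
      ∀ z, ‖z‖ ≤ 1 → ‖P.eval z‖ = ‖B z‖ * ‖Q.eval z‖ := by
  obtain ⟨m, hm, a, ha, hB⟩ := hB
  refine ⟨X ^ m * ∏ j, (X - Polynomial.C (a j)),
    ∏ j, (1 - Polynomial.C ((starRingEnd ℂ) (a j)) * X), ?_, ?_, fun z hz => ?_, fun z hz => ?_⟩
  · exact (monic_X_pow m).mul (monic_prod_of_monic _ _ fun j _ => monic_X_sub_C _)
  · rw [(monic_X_pow m).natDegree_mul (monic_prod_of_monic _ _ fun j _ => monic_X_sub_C _),
      natDegree_X_pow, natDegree_prod_of_monic _ _ fun j _ => monic_X_sub_C _]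
    simp [hm]
  · simp only [eval_mul, eval_pow, eval_X, eval_prod, Polynomial.eval_sub, eval_C, eval_one, norm_mul,
      norm_pow, norm_prod, hz, one_pow, one_mul]
    refine Finset.prod_congr rfl fun j _ => ?_
    have h1 : z * (starRingEnd ℂ) z = 1 := by rw [Complex.mul_conj', hz]; simp
    -- Reflection in the circle: a zero factor and its denominator agree in modulus there.
    have h2 : z - a j = z * (starRingEnd ℂ) (1 - (starRingEnd ℂ) (a j) * z) := by
      simp only [map_sub, map_one, map_mul, Complex.conj_conj]
      linear_combination (a j) * h1
    rw [h2, norm_mul, hz, RCLike.norm_conj, one_mul]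
  · simp only [hB, eval_mul, eval_pow, eval_X, eval_prod, Polynomial.eval_sub, eval_C, eval_one, norm_mul,
      norm_pow, norm_prod, norm_div]
    rw [mul_assoc, ← Finset.prod_mul_distrib]
    congr 1
    refine Finset.prod_congr rfl fun j _ => ?_
    have hne : ‖1 - (starRingEnd ℂ) (a j) * z‖ ≠ 0 := by
      rw [norm_ne_zero_iff, sub_ne_zero]
      intro h
      have := congrArg norm h
      rw [norm_one, norm_mul, RCLike.norm_conj] at this
      nlinarith [(ha j).1, norm_nonneg (a j), norm_nonneg z]
    rw [div_mul_cancel₀ _ hne, norm_sub_rev]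

/-- Replacing `P` by `Q` keeps the `H²` norm, since the moduli agree on the circle, while at the
values with `‖w‖ ≤ r` it gains the factor `‖B w‖`. -/
theorem enorm_sq_comp_mul_le {φ φb : ℂ → ℂ} (hb : IsBoundaryFunction φ φb)
    (hφ : DifferentiableOn ℂ φ (ball 0 1)) (hmaps : MapsTo φ (ball 0 1) (ball 0 1))
    {C : HardyTwo →L[ℂ] HardyTwo} (hC : IsCompositionOperator φ C) {B : ℂ → ℂ} {P Q : ℂ[X]}
    (hPQ : ∀ z, ‖z‖ = 1 → ‖P.eval z‖ = ‖Q.eval z‖)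
    (hPB : ∀ z, ‖z‖ ≤ 1 → ‖P.eval z‖ = ‖B z‖ * ‖Q.eval z‖) {r : ℝ} (hr : r < 1) (p : ℂ[X]) :
    ‖C (ofPolynomial (P * p))‖ₑ ^ 2 ≤
      ((⨆ z ∈ {z : ℂ | z ∈ sphere (0 : ℂ) 1 ∧ ‖φb z‖ ≤ r}, ‖B (φb z)‖ₑ ^ 2) * ‖C‖ₑ ^ 2
        + carlesonNorm (pullbackMeasure φb r)) * ‖ofPolynomial (P * p)‖ₑ ^ 2 := by
  set S := ⨆ z ∈ {z : ℂ | z ∈ sphere (0 : ℂ) 1 ∧ ‖φb z‖ ≤ r}, ‖B (φb z)‖ₑ ^ 2 with hS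
  set ν := circleSigma.map φb with hν
  have hφm := hb.aemeasurable hφ
  have hset : MeasurableSet {w : ℂ | r < ‖w‖} := measurableSet_lt measurable_const measurable_norm
  have hnorm : ‖ofPolynomial (P * p)‖ₑ ^ 2 = ‖ofPolynomial (Q * p)‖ₑ ^ 2 := by
    rw [enorm_sq_ofPolynomial, enorm_sq_ofPolynomial]
    refine lintegral_congr_ae ?_
    filter_upwards [ae_circleSigma_norm_eq_one] with z hz
    rw [← ofReal_norm, ← ofReal_norm, eval_mul, eval_mul, norm_mul, norm_mul, hPQ z hz]
  have hfar : ∫⁻ w in {w : ℂ | r < ‖w‖}, ‖(P * p).eval w‖ₑ ^ 2 ∂ν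
      ≤ carlesonNorm (pullbackMeasure φb r) * ‖ofPolynomial (P * p)‖ₑ ^ 2 := by
    refine le_trans (le_of_eq ?_) (lintegral_ext_sq_le _ _)
    simp only [ext_ofPolynomial]
    rw [pullbackMeasure, Measure.restrict_eq_self_of_ae_mem (s := closedBall (0 : ℂ) 1)]
    refine ae_restrict_of_ae ?_
    refine (ae_map_iff hφm (p := fun w => w ∈ closedBall 0 1) measurableSet_closedBall).2 ?_
    simpa using hb.ae_norm_le_one hmaps
  have hptw : ∀ᵐ w ∂ν, ‖w‖ ≤ r → ‖(P * p).eval w‖ₑ ^ 2 ≤ S * ‖(Q * p).eval w‖ₑ ^ 2 := by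
    rw [hν, ae_map_iff hφm]
    · filter_upwards [ae_circleSigma_norm_eq_one] with z hz hzr
      have hle : ‖B (φb z)‖ₑ ^ 2 ≤ S :=
        le_iSup₂ (f := fun z (_ : z ∈ {z : ℂ | z ∈ sphere (0 : ℂ) 1 ∧ ‖φb z‖ ≤ r}) =>
          ‖B (φb z)‖ₑ ^ 2) z ⟨by simpa using hz, hzr⟩
      have h1 := hPB (φb z) (hzr.trans hr.le)
      have h2 : ‖P.eval (φb z)‖ₑ = ‖B (φb z)‖ₑ * ‖Q.eval (φb z)‖ₑ := by
        rw [← ofReal_norm, h1, ENNReal.ofReal_mul (norm_nonneg _), ofReal_norm, ofReal_norm]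
      simp only [eval_mul, enorm_mul, mul_pow, h2, ← mul_assoc]
      gcongr
    · have e : {w : ℂ | ‖w‖ ≤ r → ‖(P * p).eval w‖ₑ ^ 2 ≤ S * ‖(Q * p).eval w‖ₑ ^ 2}
          = {w : ℂ | r < ‖w‖} ∪ {w : ℂ | ‖(P * p).eval w‖ₑ ^ 2 ≤ S * ‖(Q * p).eval w‖ₑ ^ 2} := by
        ext w
        simp only [mem_ofPred_eq, mem_union, imp_iff_not_or, not_le]
      rw [e]
      refine hset.union (measurableSet_le ?_ ?_)
      · exact (Continuous.measurable (by fun_prop)).enorm.pow_const 2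
      · exact ((Continuous.measurable (by fun_prop)).enorm.pow_const 2).const_mul S
  have hnear : ∫⁻ w in {w : ℂ | r < ‖w‖}ᶜ, ‖(P * p).eval w‖ₑ ^ 2 ∂ν
      ≤ S * ‖C‖ₑ ^ 2 * ‖ofPolynomial (P * p)‖ₑ ^ 2 := by
    calc _ ≤ ∫⁻ w in {w : ℂ | r < ‖w‖}ᶜ, S * ‖(Q * p).eval w‖ₑ ^ 2 ∂ν := by
          refine lintegral_mono_ae ?_
          rw [ae_restrict_iff' hset.compl]
          filter_upwards [hptw] with w hw hwr using hw (by simpa using hwr)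
      -- Restoring the region `r < ‖w‖` turns the integral into a full norm `‖C (Q p)‖²`.
      _ ≤ ∫⁻ w, S * ‖(Q * p).eval w‖ₑ ^ 2 ∂ν := setLIntegral_le_lintegral _ _
      _ = S * ‖C (ofPolynomial (Q * p))‖ₑ ^ 2 := by
          rw [lintegral_const_mul _ ((Continuous.measurable (by fun_prop)).enorm.pow_const 2),
            enorm_sq_comp_ofPolynomial hb hφ hmaps hC]
      _ ≤ S * (‖C‖ₑ * ‖ofPolynomial (Q * p)‖ₑ) ^ 2 := by
          gcongr
          exact C.le_opENorm _
      _ = _ := by rw [mul_pow, hnorm, mul_assoc]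
  rw [enorm_sq_comp_ofPolynomial hb hφ hmaps hC, ← lintegral_add_compl _ hset, add_mul, add_comm]
  exact add_le_add hnear hfar

/-- The closed subspace of `H²` generated by the multiples of a polynomial. -/
noncomputable def HardyTwo.multiplesClosure (P : ℂ[X]) : Submodule ℂ HardyTwo :=
  (LinearMap.range (ofPolynomial ∘ₗ LinearMap.mulLeft ℂ P)).topologicalClosure

noncomputable instance (P : ℂ[X]) : CompleteSpace (multiplesClosure P) :=
  (Submodule.isClosed_topologicalClosure _).completeSpace_coe

/-- Modulo multiples of `P` a polynomial equals its remainder of degree less than `deg P`. The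
images of these remainders span a finite-dimensional, hence closed, space, and density of
polynomials extends the conclusion to `H²`. -/
theorem rank_starProjection_multiplesClosure_le {P : ℂ[X]} (hP : P.Monic) :
    LinearMap.rank ((multiplesClosure P)ᗮ.starProjection : HardyTwo →ₗ[ℂ] HardyTwo)
      ≤ (P.natDegree : Cardinal) := by
  set Γ := (multiplesClosure P)ᗮ.starProjection with hΓ
  set T : ℂ[X] →ₗ[ℂ] HardyTwo := (Γ : HardyTwo →ₗ[ℂ] HardyTwo) ∘ₗ ofPolynomial with hT
  set W := (degreeLT ℂ P.natDegree).map T with hW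
  have hrankW : Module.rank ℂ W ≤ (P.natDegree : Cardinal) := by
    refine (rank_map_le T _).trans (le_of_eq ?_)
    rw [(degreeLTEquiv ℂ P.natDegree).rank_eq, rank_fin_fun]
  have hfin : FiniteDimensional ℂ W :=
    Module.rank_lt_aleph0_iff.1 (hrankW.trans_lt (Cardinal.natCast_lt_aleph0 (n := P.natDegree)))
  have hpoly : ∀ q, Γ (ofPolynomial q) ∈ W := by
    intro q
    have h0 : Γ (ofPolynomial (P * (q /ₘ P))) = 0 := by
      rw [hΓ, Submodule.starProjection_apply_eq_zero_iff]
      refine Submodule.le_orthogonal_orthogonal _ ?_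
      exact Submodule.le_topologicalClosure _ ⟨q /ₘ P, rfl⟩
    refine ⟨q %ₘ P, ?_, ?_⟩
    · rw [SetLike.mem_coe, mem_degreeLT, ← degree_eq_natDegree hP.ne_zero]
      exact degree_modByMonic_lt q hP
    · conv_rhs => rw [← modByMonic_add_div q P, map_add, map_add, h0, add_zero]
      rfl
  have hrange : LinearMap.range (Γ : HardyTwo →ₗ[ℂ] HardyTwo) ≤ W := by
    rintro _ ⟨f, rfl⟩
    have hcl : IsClosed (Γ ⁻¹' (W : Set HardyTwo)) :=
      W.closed_of_finiteDimensional.preimage Γ.continuous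
    refine hcl.closure_subset_iff.2 ?_ (mem_closure_range_ofPolynomial f)
    rintro _ ⟨q, rfl⟩
    exact hpoly q
  exact (Submodule.rank_mono hrange).trans hrankW

/-- The upper bound for approximation numbers by Blaschke products. -/
theorem approxNumber_le {φ φb : ℂ → ℂ} (hb : IsBoundaryFunction φ φb)
    (hφ : DifferentiableOn ℂ φ (ball 0 1)) (hmaps : MapsTo φ (ball 0 1) (ball 0 1))
    {C : HardyTwo →L[ℂ] HardyTwo} (hC : IsCompositionOperator φ C) {n : ℕ} (hn : 1 ≤ n)
    {B : ℂ → ℂ} (hB : IsBlaschkeProduct (n - 1) B) {r : ℝ} (hr : r < 1) :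
    approxNumber n C ≤
      ((⨆ z ∈ {z : ℂ | z ∈ sphere (0 : ℂ) 1 ∧ ‖φb z‖ ≤ r}, ‖B (φb z)‖ₑ ^ 2) * ‖C‖ₑ ^ 2
        + carlesonNorm (pullbackMeasure φb r)) ^ (1 / 2 : ℝ) := by
  obtain ⟨P, Q, hPm, hPd, hPQ, hPB⟩ := hB.exists_polynomials
  have hpoly := enorm_sq_comp_mul_le hb hφ hmaps hC hPQ hPB hr
  set L := (⨆ z ∈ {z : ℂ | z ∈ sphere (0 : ℂ) 1 ∧ ‖φb z‖ ≤ r}, ‖B (φb z)‖ₑ ^ 2) * ‖C‖ₑ ^ 2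
        + carlesonNorm (pullbackMeasure φb r) with hL
  by_cases hLt : L = ∞
  · simp [hLt]
  set E := multiplesClosure P with hE
  -- The inequality is a closed condition, so it passes from multiples of `P` to their closure.
  have hbound : ∀ f ∈ E, ‖C f‖ ≤ √L.toReal * ‖f‖ := by
    have hcl : IsClosed {f : HardyTwo | ‖C f‖ ≤ √L.toReal * ‖f‖} :=
      isClosed_le (by fun_prop) (by fun_prop)
    intro f hf
    refine hcl.closure_subset_iff.2 ?_ hf
    rintro _ ⟨p, rfl⟩
    have h := hpoly p
    rw [← ENNReal.ofReal_toReal hLt, ← ofReal_norm, ← ofReal_norm,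
      ← ENNReal.ofReal_pow (norm_nonneg _), ← ENNReal.ofReal_pow (norm_nonneg _),
      ← ENNReal.ofReal_mul ENNReal.toReal_nonneg,
      ENNReal.ofReal_le_ofReal_iff (by positivity)] at h
    have h2 := Real.le_sqrt_of_sq_le h
    rwa [Real.sqrt_mul ENNReal.toReal_nonneg, Real.sqrt_sq (norm_nonneg _)] at h2
  -- The error of the finite-rank approximation only sees the component in `E`.
  have hdiff : ∀ f, (C - C ∘L Eᗮ.starProjection) f = C (E.starProjection f) := by
    intro f
    have := Submodule.starProjection_add_starProjection_orthogonal (K := E) f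
    rw [_root_.sub_apply, ContinuousLinearMap.comp_apply, ← map_sub]
    congr 1
    exact sub_eq_of_eq_add this.symm
  have hop : ‖C - C ∘L Eᗮ.starProjection‖ ≤ √L.toReal := by
    refine ContinuousLinearMap.opNorm_le_bound _ (Real.sqrt_nonneg _) fun f => ?_
    rw [hdiff]
    refine (hbound _ (E.starProjection_apply_mem f)).trans ?_
    gcongr
    exact E.norm_starProjection_apply_le f
  have hrank : C ∘L Eᗮ.starProjection ∈ {R : HardyTwo →L[ℂ] HardyTwo |
      LinearMap.rank (R : HardyTwo →ₗ[ℂ] HardyTwo) < (n : Cardinal)} := by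
    refine (LinearMap.rank_comp_le_right (Eᗮ.starProjection : HardyTwo →ₗ[ℂ] HardyTwo)
      (C : HardyTwo →ₗ[ℂ] HardyTwo)).trans_lt ?_
    refine (rank_starProjection_multiplesClosure_le hPm).trans_lt ?_
    rw [hPd]
    exact_mod_cast Nat.sub_lt hn one_pos
  refine (infEDist_le_edist_of_mem hrank).trans ?_
  rw [edist_eq_enorm_sub, ← ofReal_norm]
  refine (ENNReal.ofReal_le_ofReal hop).trans (le_of_eq ?_)
  rw [Real.sqrt_eq_rpow, ← ENNReal.ofReal_rpow_of_nonneg ENNReal.toReal_nonneg (by norm_num),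
    ENNReal.ofReal_toReal hLt]

end

theorem theorem3p1 (φ : ℂ → ℂ)
    (hφ : DifferentiableOn ℂ φ (Metric.ball 0 1))
    (hmaps : Set.MapsTo φ (Metric.ball 0 1) (Metric.ball 0 1)) :
    -- `C_φ` is a well defined bounded operator, and the boundary function of `φ` exists
    (∃! C : HardyTwo →L[ℂ] HardyTwo, IsCompositionOperator φ C) ∧
    (∃ φb : ℂ → ℂ, IsBoundaryFunction φ φb) ∧
    ∀ C : HardyTwo →L[ℂ] HardyTwo, IsCompositionOperator φ C → ∀ n : ℕ, 1 ≤ n →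
      -- (a)
      (∀ φb : ℂ → ℂ, IsBoundaryFunction φ φb →
        ∀ B : ℂ → ℂ, IsBlaschkeProduct (n - 1) B → ∀ r : ℝ, 0 < r → r < 1 →
          approxNumber n C ≤
            ((⨆ z ∈ {z : ℂ | z ∈ Metric.sphere (0 : ℂ) 1 ∧ ‖φb z‖ ≤ r}, ‖B (φb z)‖ₑ ^ 2)
                * ‖C‖ₑ ^ 2
              + carlesonNorm (pullbackMeasure φb r)) ^ (1 / 2 : ℝ)) ∧
      -- (b)
      (∀ Z : Fin n → ℂ, (∀ j, Z j ∈ Metric.ball (0 : ℂ) 1) → Function.Injective Z →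
        Function.Injective (fun j => φ (Z j)) →
          (interpolationConst fun j => φ (Z j))⁻¹
              * carlesonNorm (sequenceMeasure Z) ^ (-(1 / 2) : ℝ)
              * ⨅ j, ENNReal.ofReal ((1 - ‖Z j‖ ^ 2) / (1 - ‖φ (Z j)‖ ^ 2)) ^ (1 / 2 : ℝ)
            ≤ approxNumber n C) := by
  refine ⟨existsUnique_isCompositionOperator hφ hmaps, exists_isBoundaryFunction hφ hmaps,
    fun C hC n hn => ⟨fun φb hb B hB r _ hr => approxNumber_le hb hφ hmaps hC hn hB hr,
      fun Z hZ _ _ => le_approxNumber hmaps hC hn hZ⟩⟩
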